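/- **Theorem 3.8.** Let $E$ be a Polish space, $\alpha$ a Borel probability measure on $E$, and $X_1,X_2,\dots$ i.i.d. $E$-valued random variables with law $\alpha$; put $L_n=\frac1n\sum_{i=1}^n\delta_{X_i}$. Let $B=\mathbb R^d$, equipped with some norm $\|\cdot\|$, let $F:E\to B$ be measurable and let $K\subseteq B$ be closed and convex. Assume that $\int e^{s\|F\|}\,d\alpha<\infty$ for some $s>0$, that $$\Big\{\lambda\in B' : \int e^{\langle\lambda,F\rangle}\,d\alpha<\infty\Big\}$$ is open in the dual $B'$ of $B$, and that $K\cap \operatorname{int}(S)\neq\emptyset$, where $S$ is the convex hull of the support of the image measure $F_\#\alpha$. Let $a>0$ be a type 2 constant of $B$, i.e. $\mathbb E\|\sum_{i=1}^n Z_i\|^2\le a\sum_{i=1}^n\mathbb E\|Z_i\|^2$ for all $n$ and all i.i.d. square integrable centered $B$-valued $Z_i$ with $\mathbb E\|Z_i\|^2=1$ (for a Euclidean norm, $a=1$). For probability measures write $H(\beta\mid\gamma)=\int\log\frac{d\beta}{d\gamma}\,d\beta$ if $\beta\ll\gamma$ and this is finite, and $H(\beta\mid\gamma)=+\infty$ otherwise.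 For $\varepsilon\ge 0$ let $K^{\varepsilon}=\{x\in B: d(x,K)\le\varepsilon\}$. Let $C$ (resp. $C_n$) be the set of probability measures $\nu$ on $E$ such that $F$ is $\nu$-integrable and $\int F\,d\nu\in K$ (resp. $\int F\,d\nu\in K^{\varepsilon_n}$). Then $\alpha$ has an $I$-projection $\alpha^*$ on $C$, i.e. there is a unique $\alpha^*\in C$ with $H(\alpha^*\mid\alpha)=\inf_{\nu\in C}H(\nu\mid\alpha)<\infty$; moreover $\int\|F\|^2\,d\alpha^*<\infty$. Let $c=\sqrt{a\int\|F-\int F\,d\alpha^*\|^2\,d\alpha^*}$. For every sequence $\varepsilon_n\to0$ with $\varepsilon_n>c/\sqrt n$ for all $n\ge1$, one has $\mathbb P(L_n\in C_n)>0$ for all large $n$, and for every $k\ge1$ the conditional laws $\alpha^n_{C_n,k}=\mathcal L\big((X_1,\dots,X_k)\mid L_n\in C_n\big)$ satisfy, as $n\to\infty$, $$\big\|\alpha^n_{C_n,k}-\alpha^{*\otimes k}\big\|_\tau^*\to0\qquad\text{and}\qquad H\big(\alpha^n_{C_n,k}\mid\alpha^{*\otimes k}\big)\to0 .$$ Here $\|\nu_1-\nu_2\|^*_\tau$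 is the supremum of $\big|\int g\,d\nu_1-\int g\,d\nu_2\big|$ over all measurable $g:E^k\to\mathbb R$ such that $\int e^{s|g|}\,d\alpha^{\otimes k}<\infty$ for some $s>0$ and $\|g\|_\tau\le1$, with the convention that it is $+\infty$ if some such $g$ is not integrable under $\nu_1$ or $\nu_2$, where $$\|g\|_\tau=\inf\Big\{s>0:\int\tau(g/s)\,d\alpha^{\otimes k}\le1\Big\},\qquad \tau(u)=e^{|u|}-|u|-1 .$$ -/

import Mathlib

open MeasureTheory ProbabilityTheory Filter Topology
open scoped ENNReal

noncomputable section

namespace ThinSets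

/-- The Young function `τ(u) = e^{|u|} - |u| - 1`. -/
def tau (u : ℝ) : ℝ := Real.exp |u| - |u| - 1

/-- Membership in the Orlicz space `L_τ(α)`: `g` is measurable and some exponential moment
`∫ e^{s|g|} dα` with `s > 0` is finite. -/
def MemOrlicz {E : Type*} [MeasurableSpace E] (g : E → ℝ) (α : Measure E) : Prop :=
  Measurable g ∧ ∃ s : ℝ, 0 < s ∧ ∫⁻ x, ENNReal.ofReal (Real.exp (s * |g x|)) ∂α < ∞

/-- The Luxemburg norm `inf {s > 0 : ∫ τ(g/s) dα ≤ 1}` (the set is nonempty for `g ∈ L_τ(α)`). -/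
def luxemburgNorm {E : Type*} [MeasurableSpace E] (g : E → ℝ) (α : Measure E) : ℝ :=
  sInf {s : ℝ | 0 < s ∧ ∫⁻ x, ENNReal.ofReal (tau (g x / s)) ∂α ≤ 1}

open Classical in
/-- The dual norm `‖ν₁ - ν₂‖*_τ` on the dual of `L_τ(α)`: the supremum of `|∫ g dν₁ - ∫ g dν₂|`
over the unit ball of `L_τ(α)`. Its value is `∞` if some `g` of the unit ball fails to be integrable
with respect to `ν₁` or `ν₂`. -/
def orliczDualDist {E : Type*} [MeasurableSpace E] (α ν₁ ν₂ : Measure E) : ℝ≥0∞ :=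
  ⨆ g ∈ {g : E → ℝ | MemOrlicz g α ∧ luxemburgNorm g α ≤ 1},
    if Integrable g ν₁ ∧ Integrable g ν₂ then
      ENNReal.ofReal |(∫ x, g x ∂ν₁) - ∫ x, g x ∂ν₂|
    else ∞

/-- The Laplace transform `Z_F(l) = ∫ e^{⟨l, F⟩} dα`, with values in `[0, ∞]`. -/
def laplaceTransform {E B : Type*} [MeasurableSpace E] [NormedAddCommGroup B] [NormedSpace ℝ B]
    (F : E → B) (α : Measure E) (l : B →L[ℝ] ℝ) : ℝ≥0∞ :=
  ∫⁻ x, ENNReal.ofReal (Real.exp (l (F x))) ∂α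

/-- The domain `{l ∈ B' : Λ_F(l) < ∞}` of `Λ_F = log Z_F`. It contains `0` if `α` is finite. -/
def domLogLaplace {E B : Type*} [MeasurableSpace E] [NormedAddCommGroup B] [NormedSpace ℝ B]
    (F : E → B) (α : Measure E) : Set (B →L[ℝ] ℝ) :=
  {l | laplaceTransform F α l < ∞}

/-- The constraint `{ν ∈ M₁(E) : ∫ F dν ∈ K}`, with `F` Bochner integrable under `ν`. -/
def momentConstraint {E B : Type*} [MeasurableSpace E] [NormedAddCommGroup B] [NormedSpace ℝ B]
    (F : E → B) (K : Set B) : Set (Measure E) :=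
  {ν | IsProbabilityMeasure ν ∧ Integrable F ν ∧ ∫ x, F x ∂ν ∈ K}

/-- `β` is the `I`-projection of `α` on `C`: it lies in `C` and minimizes the relative entropy
`H(· | α)` over `C`, with a finite minimum. -/
def IsIProjection {E : Type*} [MeasurableSpace E] (α : Measure E) (C : Set (Measure E))
    (β : Measure E) : Prop :=
  β ∈ C ∧ InformationTheory.klDiv β α < ∞ ∧
    ∀ ν ∈ C, InformationTheory.klDiv β α ≤ InformationTheory.klDiv ν α

/-- The variance `∫ ‖F - ∫ F dβ‖² dβ` of a `B`-valued map. -/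
def vecVariance {E B : Type*} [MeasurableSpace E] [NormedAddCommGroup B] [NormedSpace ℝ B]
    (F : E → B) (β : Measure E) : ℝ :=
  ∫ x, ‖F x - ∫ y, F y ∂β‖ ^ 2 ∂β

/-- `a > 0` is a type 2 constant of `B`: for i.i.d. square integrable centered `B`-valued
`Z₁, …, Z_n` with variance `1` (their common law is `μ`, so their joint law is `μ^{⊗n}`),
`𝔼 ‖∑ Z_i‖² ≤ a ∑ 𝔼 ‖Z_i‖²`. -/
def IsTypeTwoConst (B : Type*) [NormedAddCommGroup B] [NormedSpace ℝ B] [MeasurableSpace B]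
    (a : ℝ) : Prop :=
  0 < a ∧ ∀ μ : Measure B, IsProbabilityMeasure μ → MemLp (fun z : B => z) 2 μ →
    ∫ z, z ∂μ = 0 → ∫ z, ‖z‖ ^ 2 ∂μ = 1 → ∀ n : ℕ,
      ∫ z : Fin n → B, ‖∑ i, z i‖ ^ 2 ∂(Measure.pi fun _ => μ) ≤
        a * ∑ i : Fin n, ∫ z : Fin n → B, ‖z i‖ ^ 2 ∂(Measure.pi fun _ => μ)

/-- The empirical measure `L_n = (1/n) ∑_{i < n} δ_{X_i}`. -/
def empiricalMeasure {Ω E : Type*} [MeasurableSpace E] (X : ℕ → Ω → E) (n : ℕ) (ω : Ω) :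
    Measure E :=
  (n : ℝ≥0∞)⁻¹ • ∑ i ∈ Finset.range n, Measure.dirac (X i ω)

/-- The conditional law of the first `k` variables given `L_n ∈ A`. -/
def condLaw {Ω E : Type*} [MeasurableSpace Ω] [MeasurableSpace E] (P : Measure Ω)
    (X : ℕ → Ω → E) (A : Set (Measure E)) (n k : ℕ) : Measure (Fin k → E) :=
  (ProbabilityTheory.cond P {ω | empiricalMeasure X n ω ∈ A}).map
    (fun ω (i : Fin k) => X i ω)

end ThinSets

end

/-!
The `I`-projection is an exponential tilting. Minimizing `sup_{y ∈ K} (Λ_F(l) - ⟨l, y⟩)` over the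
dual of `B` is a coercive lower semicontinuous problem, because a point of `K` lies in the
interior of the convex hull of the support (`exists_dual_minimizer`). As the domain of `Λ_F` is
open, `Λ_F` is differentiable at the minimizer `l`, and the first-order conditions say that the
mean `m` of `F` under `α* = e^{⟨l, F⟩ - Λ_F(l)} α` lies in `K` and that `l` attains its minimum
over `K` at `m` (`exists_tilt`). The Pythagorean inequality then makes `α*` the unique
`I`-projection (`isIProjection_tilted`).

On the event that the empirical mean of `F` is `ε_n`-close to `K`, the density of `α^n` with
respect to `α*^n` is at most `e^{n (Λ_F(l) - ⟨l, m⟩ + ‖l‖ ε_n)}`, and the inverse bound holds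
where that mean is `ε_n`-close to `m`. Hence the conditioned law has a density with respect to
`α*^n` of order at most `e^{2 n ‖l‖ ε_n}` divided by the `α*^n`-probability that `‖∑ (F(x_i) - m)‖
≤ n ε_n` (`cond_pi_momentEvent_le`). Since `n ε_n` may exceed the critical radius `c √n` by
arbitrarily little, Chebyshev's inequality alone does not bound this probability below. It is
combined with the fact that a centred non-degenerate walk can be kept bounded for `k` steps with
probability at least `p ^ k` (`eventually_exp_le_measure_norm_sum_le`); the resulting bound is
subexponential, and so is the density.

The conditioned law is exchangeable. Splitting the coordinates into about `n / k` blocks of length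
`k`, a density of at most `e^{o(n)}` on the whole forces each block to have entropy `o(1)`
relative to `α*^k` (`klDiv_block_le`, `tendsto_klDiv_of_subexponential`). Finally the entropy
controls the dual Orlicz distance (`integral_sub_integral_le`, `tendsto_orliczDualDist_zero`),
because functions in the unit ball of the Orlicz space of `α^k` have a uniform exponential moment
under `α*^k`: the density of `α*` is in `L^p(α)` for some `p > 1`, again as the domain of `Λ_F` is
open.
-/

namespace ThinSets

/-! ### Blocks of coordinates of a product measure -/

lemma map_pi_comp_injective {E ι ι' : Type*} [MeasurableSpace E] [Fintype ι] [Fintype ι']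
    (μ : Measure E) [IsProbabilityMeasure μ] {e : ι' → ι} (he : Function.Injective e) :
    (Measure.pi fun _ : ι => μ).map (fun x j => x (e j)) = Measure.pi fun _ : ι' => μ := by
  rw [← Measure.infinitePi_eq_pi, ← Measure.infinitePi_eq_pi]
  exact Measure.map_infinitePi_infinitePi_of_inj (P := fun _ : ι => μ) he

/-- Disjoint blocks of coordinates of a power measure are independent, and each of them is
distributed as a smaller power. -/
lemma lintegral_pi_prod_blocks {E ι κ κ' : Type*} [MeasurableSpace E] [Fintype ι] [Fintype κ]
    [Fintype κ'] (μ : Measure E) [IsProbabilityMeasure μ] {e : κ × κ' → ι}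
    (he : Function.Injective e) {f : (κ' → E) → ℝ≥0∞} (hf : Measurable f) :
    ∫⁻ x, ∏ j, f (fun i => x (e (j, i))) ∂(Measure.pi fun _ : ι => μ) =
      (∫⁻ y, f y ∂(Measure.pi fun _ : κ' => μ)) ^ Fintype.card κ := by
  have hmap : (Measure.pi fun _ : ι => μ).map (fun x (j : κ) (i : κ') => x (e (j, i))) =
      Measure.pi fun _ : κ => Measure.pi fun _ : κ' => μ := by
    have h1 : (fun (x : ι → E) (j : κ) (i : κ') => x (e (j, i))) =
        MeasurableEquiv.curry κ κ' E ∘ fun x p => x (e p) := rfl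
    rw [h1, ← Measure.map_map (by fun_prop) (by fun_prop), map_pi_comp_injective μ he]
    have h2 := Measure.infinitePi_map_curry (fun (_ : κ) (_ : κ') => μ)
    simp only [Measure.infinitePi_eq_pi] at h2
    exact h2
  have hind : iIndepFun (fun (j : κ) (y : κ → κ' → E) => f (y j))
      (Measure.pi fun _ : κ => Measure.pi fun _ : κ' => μ) :=
    iIndepFun_pi (X := fun _ => f) fun _ => hf.aemeasurable
  have hmeas : ∀ j : κ, Measurable fun y : κ → κ' → E => f (y j) := fun j => by fun_prop
  calc ∫⁻ x, ∏ j, f (fun i => x (e (j, i))) ∂(Measure.pi fun _ : ι => μ)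
      = ∫⁻ y, ∏ j, f (y j) ∂((Measure.pi fun _ : ι => μ).map
          (fun x (j : κ) (i : κ') => x (e (j, i)))) := by
        rw [lintegral_map (by fun_prop) (by fun_prop)]
    _ = ∏ j, ∫⁻ y, f (y j) ∂(Measure.pi fun _ : κ => Measure.pi fun _ : κ' => μ) := by
        rw [hmap]
        exact lintegral_prod_eq_prod_lintegral_of_indepFun Finset.univ _ hind hmeas
    _ = _ := by
        have : ∀ j : κ, ∫⁻ y, f (y j) ∂(Measure.pi fun _ : κ => Measure.pi fun _ : κ' => μ) =
            ∫⁻ y, f y ∂(Measure.pi fun _ : κ' => μ) := fun j =>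
          (measurePreserving_eval (fun _ : κ => Measure.pi fun _ : κ' => μ) j).lintegral_comp hf
        simp [this]

/-- A power measure conditioned on a symmetric event is exchangeable. -/
lemma map_cond_pi_eq_of_symm {E ι κ : Type*} [MeasurableSpace E] [Fintype ι] [Finite κ]
    (μ : Measure E) [IsProbabilityMeasure μ] {A : Set (ι → E)} (hA : MeasurableSet A)
    (hsymm : ∀ σ : Equiv.Perm ι, (fun x : ι → E => x ∘ σ) ⁻¹' A = A)
    {e e' : κ → ι} (he : Function.Injective e) (he' : Function.Injective e') :
    (cond (Measure.pi fun _ : ι => μ) A).map (fun x j => x (e j)) =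
      (cond (Measure.pi fun _ : ι => μ) A).map (fun x j => x (e' j)) := by
  obtain ⟨σ, hσ⟩ := Equiv.Perm.exists_extending_pair e e' he he'
  have hinv : (cond (Measure.pi fun _ : ι => μ) A).map (fun x => x ∘ σ) =
      cond (Measure.pi fun _ : ι => μ) A := by
    have hp : (Measure.pi fun _ : ι => μ).map (fun x => x ∘ σ) = Measure.pi fun _ : ι => μ :=
      map_pi_comp_injective μ σ.injective
    have hm : Measurable fun x : ι → E => x ∘ σ := by
      exact measurable_pi_lambda _ fun i => measurable_pi_apply _
    rw [ProbabilityTheory.cond, Measure.map_smul]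
    nth_rw 2 [← hsymm σ]
    rw [← Measure.restrict_map hm hA, hp]
  nth_rw 1 [← hinv]
  have hm : Measurable fun x : ι → E => x ∘ σ :=
    measurable_pi_lambda _ fun i => measurable_pi_apply _
  have hme : Measurable fun (x : ι → E) (j : κ) => x (e j) := by fun_prop
  rw [Measure.map_map hme hm]
  simp only [Function.comp_def, hσ]

lemma rnDeriv_le_of_le_smul {E : Type*} [MeasurableSpace E] {ν μ : Measure E} [SigmaFinite μ]
    {c : ℝ≥0∞} (h : ν ≤ c • μ) : ν.rnDeriv μ ≤ᵐ[μ] fun _ => c := by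
  refine ae_le_of_forall_setLIntegral_le_of_sigmaFinite (Measure.measurable_rnDeriv _ _)
    fun s _ _ => ?_
  calc ∫⁻ x in s, ν.rnDeriv μ x ∂μ ≤ ν s := Measure.setLIntegral_rnDeriv_le s
    _ ≤ (c • μ) s := h s
    _ = ∫⁻ _ in s, c ∂μ := by simp

lemma klDiv_ne_top_of_le_smul {E : Type*} [MeasurableSpace E] {ν μ : Measure E}
    [IsFiniteMeasure ν] [IsFiniteMeasure μ] {c : ℝ≥0∞} (hc : c ≠ ∞) (h : ν ≤ c • μ) :
    InformationTheory.klDiv ν μ ≠ ∞ := by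
  have hac : ν ≪ μ := Measure.absolutelyContinuous_of_le_smul h
  rw [InformationTheory.klDiv_eq_lintegral_klFun_of_ac hac]
  obtain ⟨C, hC⟩ := (isCompact_Icc (a := (0 : ℝ)) (b := c.toReal)).bddAbove_image
    InformationTheory.continuous_klFun.continuousOn
  refine ((lintegral_mono_ae (g := fun _ => ENNReal.ofReal C) ?_).trans_lt ?_).ne
  · filter_upwards [rnDeriv_le_of_le_smul h] with x hx
    refine ENNReal.ofReal_le_ofReal (hC ⟨_, ⟨ENNReal.toReal_nonneg, ?_⟩, rfl⟩)
    exact ENNReal.toReal_mono hc hx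
  · simpa using ENNReal.mul_lt_top ENNReal.ofReal_lt_top (measure_lt_top μ _)

/-- Superadditivity of entropy relative to a product measure, for bounded densities: if `ν` has
density at most `e^δ` with respect to a power measure and has the same marginal on `m` disjoint
blocks of coordinates, the relative entropy of that marginal is at most `δ / m`. -/
lemma klDiv_block_le {E ι κ κ' : Type*} [MeasurableSpace E] [Fintype ι] [Fintype κ]
    [Fintype κ'] [Nonempty κ] (μ : Measure E) [IsProbabilityMeasure μ] (ν : Measure (ι → E))
    [IsProbabilityMeasure ν] {δ : ℝ}
    (hν : ν ≤ ENNReal.ofReal (Real.exp δ) • Measure.pi fun _ : ι => μ)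
    {e : κ × κ' → ι} (he : Function.Injective e) (νb : Measure (κ' → E))
    (hb : ∀ j, ν.map (fun x i => x (e (j, i))) = νb) :
    InformationTheory.klDiv νb (Measure.pi fun _ : κ' => μ) ≤
      ENNReal.ofReal (δ / Fintype.card κ) := by
  have hmb : ∀ j, Measurable fun (x : ι → E) (i : κ') => x (e (j, i)) := fun j => by fun_prop
  have hbp : IsProbabilityMeasure νb := by
    rw [← hb (Classical.arbitrary κ)]
    exact Measure.isProbabilityMeasure_map (hmb _).aemeasurable
  set π := Measure.pi fun _ : κ' => μ
  have hle : νb ≤ ENNReal.ofReal (Real.exp δ) • π := by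
    have j : κ := Classical.arbitrary κ
    rw [← hb j]
    refine (Measure.map_mono hν (hmb j)).trans_eq ?_
    rw [Measure.map_smul, map_pi_comp_injective μ
      (e := fun i => e (j, i)) fun a b hab => (Prod.mk.inj (he hab)).2]
  have hne := klDiv_ne_top_of_le_smul ENNReal.ofReal_ne_top hle
  obtain ⟨hac, hint⟩ := InformationTheory.klDiv_ne_top_iff.1 hne
  rw [← ENNReal.ofReal_toReal hne,
    InformationTheory.toReal_klDiv_of_measure_eq hac (by simp [π])]
  refine ENNReal.ofReal_le_ofReal ?_
  rw [le_div_iff₀ (by exact_mod_cast Fintype.card_pos)]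
  -- `Y` is the sum over the blocks of the log-likelihood ratio of the marginal.
  set Y : (ι → E) → ℝ := fun x => ∑ j : κ, llr νb π (fun i => x (e (j, i)))
  have hYm : Measurable Y := Finset.measurable_sum _ fun j _ =>
    (measurable_llr _ _).comp (hmb j)
  have hjint : ∀ j : κ, Integrable (fun x : ι → E => llr νb π (fun i => x (e (j, i)))) ν :=
    fun j => by
      have h1 : Integrable (llr νb π) (ν.map fun x i => x (e (j, i))) := by rwa [hb j]
      exact h1.comp_measurable (hmb j)
  have hYint : Integrable Y ν := integrable_finsetSum _ fun j _ => hjint j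
  have hY : ∫ x, Y x ∂ν = (∫ y, llr νb π y ∂νb) * Fintype.card κ := by
    rw [integral_finsetSum _ fun j _ => hjint j]
    have : ∀ j : κ, ∫ x, llr νb π (fun i => x (e (j, i))) ∂ν = ∫ y, llr νb π y ∂νb := fun j => by
      have h1 := integral_map (μ := ν) (hmb j).aemeasurable
        (measurable_llr νb π).aestronglyMeasurable
      rw [← h1, hb j]
    simp [this, mul_comm]
  rw [← hY]
  have hexp : ∫⁻ x, ENNReal.ofReal (Real.exp (Y x)) ∂ν ≤ ENNReal.ofReal (Real.exp δ) := by
    calc ∫⁻ x, ENNReal.ofReal (Real.exp (Y x)) ∂ν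
        ≤ ∫⁻ x, ∏ j, νb.rnDeriv π (fun i => x (e (j, i))) ∂ν := by
          refine lintegral_mono_ae ?_
          have : ∀ᵐ x ∂ν, ∀ j : κ, Real.exp (llr νb π fun i => x (e (j, i))) =
              (νb.rnDeriv π fun i => x (e (j, i))).toReal := by
            rw [ae_all_iff]
            intro j
            have h1 := exp_llr_of_ac νb π hac
            have h2 : ∀ᵐ y ∂(ν.map fun x i => x (e (j, i))),
                Real.exp (llr νb π y) = (νb.rnDeriv π y).toReal := by rw [hb j]; exact h1
            exact ae_of_ae_map (hmb j).aemeasurable h2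
          filter_upwards [this] with x hx
          rw [Real.exp_sum, ENNReal.ofReal_prod_of_nonneg fun _ _ => (Real.exp_pos _).le]
          refine Finset.prod_le_prod' fun j _ => ?_
          rw [hx j]
          exact ENNReal.ofReal_toReal_le
      _ ≤ ∫⁻ x, ∏ j, νb.rnDeriv π (fun i => x (e (j, i)))
            ∂(ENNReal.ofReal (Real.exp δ) • Measure.pi fun _ : ι => μ) := lintegral_mono' hν le_rfl
      _ = ENNReal.ofReal (Real.exp δ) * (∫⁻ y, νb.rnDeriv π y ∂π) ^ Fintype.card κ := by
          rw [lintegral_smul_measure,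
            lintegral_pi_prod_blocks μ he (Measure.measurable_rnDeriv νb π), smul_eq_mul]
      _ = ENNReal.ofReal (Real.exp δ) := by
          rw [Measure.lintegral_rnDeriv hac]
          simp
  have hexpint : Integrable (fun x => Real.exp (Y x)) ν := by
    refine ⟨hYm.exp.aestronglyMeasurable, ?_⟩
    rw [hasFiniteIntegral_iff_ofReal (ae_of_all _ fun _ => (Real.exp_pos _).le)]
    exact hexp.trans_lt ENNReal.ofReal_lt_top
  have hexp' : ∫ x, Real.exp (Y x) ∂ν ≤ Real.exp δ := by
    rw [integral_eq_lintegral_of_nonneg_ae (ae_of_all _ fun _ => (Real.exp_pos _).le)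
      hYm.exp.aestronglyMeasurable]
    exact ENNReal.toReal_le_of_le_ofReal (Real.exp_pos _).le hexp
  -- Jensen's inequality for `exp`, through its tangent line at `δ`.
  calc ∫ x, Y x ∂ν ≤ ∫ x, (δ - 1 + Real.exp (-δ) * Real.exp (Y x)) ∂ν := by
        refine integral_mono hYint ((integrable_const _).add (hexpint.const_mul _)) fun x => ?_
        have := Real.add_one_le_exp (Y x - δ)
        simp only [← Real.exp_add]
        rw [show -δ + Y x = Y x - δ by ring]
        linarith
    _ = δ - 1 + Real.exp (-δ) * ∫ x, Real.exp (Y x) ∂ν := by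
        rw [integral_add (integrable_const _) (hexpint.const_mul _), integral_const_mul]
        simp
    _ ≤ δ - 1 + Real.exp (-δ) * Real.exp δ := by gcongr
    _ = δ := by rw [← Real.exp_add]; simp

/-! ### Relative entropy controls the dual Orlicz distance -/

/-- The inequality behind the Gibbs variational principle; it is Young's inequality
`f h ≤ klFun f + e^h - 1` integrated, with `f` the density of `ν`. -/
lemma integral_le_klDiv_add {E : Type*} [MeasurableSpace E] {ν μ : Measure E}
    [IsProbabilityMeasure ν] [IsProbabilityMeasure μ] (hkl : InformationTheory.klDiv ν μ ≠ ∞)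
    {h : E → ℝ} (hν : Integrable h ν) (hμ : Integrable (fun x => Real.exp (h x)) μ) :
    ∫ x, h x ∂ν ≤ (InformationTheory.klDiv ν μ).toReal + (∫ x, Real.exp (h x) ∂μ - 1) := by
  obtain ⟨hac, hint⟩ := InformationTheory.klDiv_ne_top_iff.1 hkl
  have hkint := (InformationTheory.integrable_klFun_rnDeriv_iff hac).2 hint
  have h1 : Integrable (fun x => Real.exp (h x) - 1) μ := hμ.sub (integrable_const _)
  rw [InformationTheory.toReal_klDiv_eq_integral_klFun hac]
  have h2 : ∫ x, Real.exp (h x) ∂μ - 1 = ∫ x, (Real.exp (h x) - 1) ∂μ := by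
    rw [integral_sub hμ (integrable_const _)]; simp
  rw [h2, ← integral_add hkint h1, ← integral_rnDeriv_smul hac]
  refine integral_mono ((integrable_rnDeriv_smul_iff hac).2 hν) (hkint.add h1) fun x => ?_
  set f := (ν.rnDeriv μ x).toReal with hf
  have hf0 : 0 ≤ f := ENNReal.toReal_nonneg
  simp only [smul_eq_mul, InformationTheory.klFun_apply]
  rcases hf0.eq_or_lt with h0 | hpos
  · rw [← h0]; simp [(Real.exp_pos (h x)).le]
  · have h3 := Real.add_one_le_exp (h x - Real.log f)
    have h4 : Real.exp (h x) = f * Real.exp (h x - Real.log f) := by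
      rw [Real.exp_sub, Real.exp_log hpos]; field_simp
    nlinarith

lemma exp_le_one_add_add_sq_mul_exp_abs (x : ℝ) :
    Real.exp x ≤ 1 + x + x ^ 2 * Real.exp |x| := by
  have he : 1 ≤ Real.exp |x| := Real.one_le_exp (abs_nonneg x)
  rcases le_total |x| 1 with h | h
  · have := (abs_le.1 (Real.abs_exp_sub_one_sub_id_le h)).2
    nlinarith [sq_nonneg x]
  · have h2 : 1 ≤ x ^ 2 := by rw [← sq_abs]; nlinarith
    rcases le_total 0 x with h0 | h0
    · rw [abs_of_nonneg h0] at *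
      nlinarith
    · have h3 : Real.exp x ≤ 1 := Real.exp_le_one_iff.2 h0
      have h4 := Real.add_one_le_exp |x|
      rw [abs_of_nonpos h0] at *
      nlinarith

/-- Entropy bounds the change of the mean of a function with an exponential moment: the entropy
inequality is applied to `t (g - ∫ g dμ)`, whose Laplace transform is `1 + O(t²)`. -/
lemma integral_sub_integral_le {E : Type*} [MeasurableSpace E] {ν μ : Measure E}
    [IsProbabilityMeasure ν] [IsProbabilityMeasure μ] {c : ℝ≥0∞} (hc : c ≠ ∞) (hle : ν ≤ c • μ)
    {g : E → ℝ} (hg : Measurable g) {s M t : ℝ} (hM : 0 ≤ M)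
    (hexp : ∫⁻ x, ENNReal.ofReal (Real.exp (s * |g x|)) ∂μ ≤ ENNReal.ofReal M)
    (ht : 0 < t) (hts : t ≤ s / 2) :
    Integrable g ν ∧ Integrable g μ ∧ ∫ x, g x ∂ν - ∫ x, g x ∂μ ≤
      (InformationTheory.klDiv ν μ).toReal / t + 8 / s ^ 2 * (M * Real.exp M) * t := by
  have hs : 0 < s := by linarith
  have hem : Measurable fun x => Real.exp (s * |g x|) := by fun_prop
  have hei : Integrable (fun x => Real.exp (s * |g x|)) μ := by
    refine ⟨hem.aestronglyMeasurable, ?_⟩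
    rw [hasFiniteIntegral_iff_ofReal (ae_of_all _ fun _ => (Real.exp_pos _).le)]
    exact hexp.trans_lt ENNReal.ofReal_lt_top
  have heM : ∫ x, Real.exp (s * |g x|) ∂μ ≤ M := by
    rw [integral_eq_lintegral_of_nonneg_ae (ae_of_all _ fun _ => (Real.exp_pos _).le)
      hem.aestronglyMeasurable]
    exact ENNReal.toReal_le_of_le_ofReal hM hexp
  have hgabs : ∀ x, |g x| ≤ s⁻¹ * Real.exp (s * |g x|) := fun x => by
    have := Real.add_one_le_exp (s * |g x|)
    rw [inv_mul_eq_div, le_div_iff₀ hs]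
    linarith
  have hgμ : Integrable g μ := (hei.const_mul s⁻¹).mono' hg.aestronglyMeasurable
    (ae_of_all _ fun x => by rw [Real.norm_eq_abs]; exact hgabs x)
  have hgν : Integrable g ν := Integrable.of_measure_le_smul hc hle hgμ
  refine ⟨hgν, hgμ, ?_⟩
  set b := ∫ x, g x ∂μ with hb
  have hbM : s * |b| ≤ M := by
    calc s * |b| ≤ s * ∫ x, |g x| ∂μ := by
          gcongr; exact abs_integral_le_integral_abs
      _ ≤ s * ∫ x, s⁻¹ * Real.exp (s * |g x|) ∂μ := by
          exact mul_le_mul_of_nonneg_left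
            (integral_mono hgμ.abs (hei.const_mul s⁻¹) hgabs) hs.le
      _ = ∫ x, Real.exp (s * |g x|) ∂μ := by
          rw [integral_const_mul]; field_simp
      _ ≤ M := heM
  have hpt : ∀ x, Real.exp (t * (g x - b)) ≤ 1 + t * (g x - b) +
      t ^ 2 * (8 / s ^ 2) * Real.exp M * Real.exp (s * |g x|) := fun x => by
    have h1 := exp_le_one_add_add_sq_mul_exp_abs (t * (g x - b))
    have h2 := Real.quadratic_le_exp_of_nonneg (x := s / 2 * |g x - b|) (by positivity)
    have h3 : (g x - b) ^ 2 ≤ 8 / s ^ 2 * Real.exp (s / 2 * |g x - b|) := by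
      rw [div_mul_eq_mul_div, le_div_iff₀ (by positivity), ← sq_abs]
      have : 0 ≤ s / 2 * |g x - b| := by positivity
      nlinarith
    have h4 : Real.exp |t * (g x - b)| ≤ Real.exp (s / 2 * |g x - b|) := by
      rw [abs_mul, abs_of_pos ht]; gcongr
    have h5 : Real.exp (s / 2 * |g x - b|) * Real.exp (s / 2 * |g x - b|) ≤
        Real.exp M * Real.exp (s * |g x|) := by
      rw [← Real.exp_add, ← Real.exp_add, Real.exp_le_exp]
      have := abs_sub (g x) b
      nlinarith
    calc Real.exp (t * (g x - b))
        ≤ 1 + t * (g x - b) + t ^ 2 * ((g x - b) ^ 2 * Real.exp |t * (g x - b)|) := by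
          linarith [mul_pow t (g x - b) 2]
      _ ≤ 1 + t * (g x - b) + t ^ 2 * ((8 / s ^ 2 * Real.exp (s / 2 * |g x - b|)) *
            Real.exp (s / 2 * |g x - b|)) := by gcongr
      _ ≤ 1 + t * (g x - b) + t ^ 2 * (8 / s ^ 2 * (Real.exp M * Real.exp (s * |g x|))) := by
          rw [mul_assoc]; gcongr
      _ = _ := by ring
  have hlin : Integrable (fun x => t * (g x - b)) μ := (hgμ.sub (integrable_const _)).const_mul _
  have hlinν : Integrable (fun x => t * (g x - b)) ν := (hgν.sub (integrable_const _)).const_mul _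
  have hlin1 : Integrable (fun x => 1 + t * (g x - b)) μ := (integrable_const _).add hlin
  have hbd : Integrable (fun x => 1 + t * (g x - b) +
      t ^ 2 * (8 / s ^ 2) * Real.exp M * Real.exp (s * |g x|)) μ :=
    hlin1.add (hei.const_mul _)
  have hexpi : Integrable (fun x => Real.exp (t * (g x - b))) μ := by
    refine hbd.mono' (by fun_prop) (ae_of_all _ fun x => ?_)
    rw [Real.norm_eq_abs, abs_of_pos (Real.exp_pos _)]
    exact hpt x
  have hDV := integral_le_klDiv_add (klDiv_ne_top_of_le_smul hc hle) hlinν hexpi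
  have hI : ∫ x, Real.exp (t * (g x - b)) ∂μ ≤
      1 + t ^ 2 * (8 / s ^ 2) * Real.exp M * M := by
    refine (integral_mono hexpi hbd hpt).trans ?_
    rw [integral_add hlin1 (hei.const_mul _),
      integral_add (integrable_const _) hlin, integral_const_mul, integral_const_mul,
      integral_sub hgμ (integrable_const _)]
    simp only [integral_const, probReal_univ, one_smul, ← hb, sub_self, mul_zero, add_zero]
    gcongr
  rw [integral_const_mul, integral_sub hgν (integrable_const _)] at hDV
  simp only [integral_const, probReal_univ, one_smul] at hDV
  have h6 : (InformationTheory.klDiv ν μ).toReal / t + 8 / s ^ 2 * (M * Real.exp M) * t =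
      ((InformationTheory.klDiv ν μ).toReal + t ^ 2 * (8 / s ^ 2) * Real.exp M * M) / t := by
    field_simp
  rw [h6, le_div_iff₀ ht]
  linarith

lemma tau_nonneg (u : ℝ) : 0 ≤ tau u := by
  have := Real.add_one_le_exp |u|
  unfold tau; linarith

lemma exp_abs_le_two_mul_tau_add (u : ℝ) : Real.exp |u| ≤ 2 * tau u + 2 := by
  have := Real.quadratic_le_exp_of_nonneg (abs_nonneg u)
  unfold tau
  nlinarith [sq_nonneg (|u| - 1)]

lemma tau_mul_le {θ : ℝ} (h0 : 0 ≤ θ) (h1 : θ ≤ 1) (u : ℝ) :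
    tau (θ * u) ≤ θ * Real.exp |u| := by
  have hc := convexOn_exp.2 (Set.mem_univ (0 : ℝ)) (Set.mem_univ |u|) (sub_nonneg.2 h1) h0
    (by ring)
  simp only [smul_eq_mul, mul_zero, zero_add, Real.exp_zero, mul_one] at hc
  unfold tau
  rw [abs_mul, abs_of_nonneg h0]
  nlinarith [mul_nonneg h0 (abs_nonneg u)]

/-- The unit ball of the Orlicz space has a uniform exponential moment. -/
lemma lintegral_exp_half_abs_le {E : Type*} [MeasurableSpace E] {α : Measure E}
    [IsProbabilityMeasure α] {g : E → ℝ} (hg : MemOrlicz g α) (hle : luxemburgNorm g α ≤ 1) :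
    ∫⁻ x, ENNReal.ofReal (Real.exp (|g x| / 2)) ∂α ≤ 4 := by
  obtain ⟨hgm, s, hs, hsI⟩ := hg
  have hτm : Measurable tau := by unfold tau; fun_prop
  have hne : {r : ℝ | 0 < r ∧ ∫⁻ x, ENNReal.ofReal (tau (g x / r)) ∂α ≤ 1}.Nonempty := by
    set I := ∫⁻ x, ENNReal.ofReal (Real.exp (s * |g x|)) ∂α
    set θ : ℝ := (max 1 I.toReal)⁻¹ with hθ
    have hθ0 : 0 < θ := by positivity
    have hθ1 : θ ≤ 1 := inv_le_one_of_one_le₀ (le_max_left _ _)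
    refine ⟨(θ * s)⁻¹, by positivity, ?_⟩
    calc ∫⁻ x, ENNReal.ofReal (tau (g x / (θ * s)⁻¹)) ∂α
        ≤ ∫⁻ x, ENNReal.ofReal θ * ENNReal.ofReal (Real.exp (s * |g x|)) ∂α := by
          refine lintegral_mono fun x => ?_
          rw [← ENNReal.ofReal_mul hθ0.le]
          refine ENNReal.ofReal_le_ofReal ?_
          have := tau_mul_le hθ0.le hθ1 (s * g x)
          rw [abs_mul, abs_of_pos hs] at this
          rwa [div_inv_eq_mul, mul_comm, mul_assoc]
      _ = ENNReal.ofReal θ * ENNReal.ofReal I.toReal := by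
          rw [lintegral_const_mul _ (by fun_prop), ENNReal.ofReal_toReal hsI.ne]
      _ = ENNReal.ofReal (θ * I.toReal) := (ENNReal.ofReal_mul hθ0.le).symm
      _ ≤ ENNReal.ofReal 1 := by
          refine ENNReal.ofReal_le_ofReal ?_
          rw [hθ, inv_mul_le_iff₀ (by positivity), mul_one]
          exact le_max_right _ _
      _ = 1 := ENNReal.ofReal_one
  obtain ⟨r, ⟨hr0, hrI⟩, hr2⟩ := exists_lt_of_csInf_lt hne (hle.trans_lt one_lt_two)
  calc ∫⁻ x, ENNReal.ofReal (Real.exp (|g x| / 2)) ∂α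
      ≤ ∫⁻ x, (2 * ENNReal.ofReal (tau (g x / r)) + 2) ∂α := by
        refine lintegral_mono fun x => ?_
        have h1 : Real.exp (|g x| / 2) ≤ 2 * tau (g x / r) + 2 := by
          refine le_trans ?_ (exp_abs_le_two_mul_tau_add _)
          rw [abs_div, abs_of_pos hr0]
          gcongr
        refine (ENNReal.ofReal_le_ofReal h1).trans_eq ?_
        rw [ENNReal.ofReal_add (by have := tau_nonneg (g x / r); positivity) (by norm_num),
          ENNReal.ofReal_mul (by norm_num)]
        norm_num
    _ = 2 * ∫⁻ x, ENNReal.ofReal (tau (g x / r)) ∂α + 2 := by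
        rw [lintegral_add_right _ measurable_const, lintegral_const_mul _ (by fun_prop)]
        simp
    _ ≤ 2 * 1 + 2 := by gcongr
    _ = 4 := by norm_num

/-- Convergence in entropy to `μ` implies convergence in the dual Orlicz distance of `α` as soon as
the unit ball of the Orlicz space of `α` has a uniform exponential moment under `μ`. -/
lemma tendsto_orliczDualDist_zero {E : Type*} [MeasurableSpace E] {α μ : Measure E}
    [IsProbabilityMeasure α] [IsProbabilityMeasure μ] {s M : ℝ} (hs : 0 < s) (hM : 0 ≤ M)
    (hexp : ∀ g : E → ℝ, Measurable g → ∫⁻ x, ENNReal.ofReal (Real.exp (|g x| / 2)) ∂α ≤ 4 →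
      ∫⁻ x, ENNReal.ofReal (Real.exp (s * |g x|)) ∂μ ≤ ENNReal.ofReal M)
    {ν : ℕ → Measure E}
    (hν : ∀ᶠ n in atTop, IsProbabilityMeasure (ν n) ∧ ∃ c : ℝ≥0∞, c ≠ ∞ ∧ ν n ≤ c • μ)
    (hkl : Tendsto (fun n => InformationTheory.klDiv (ν n) μ) atTop (𝓝 0)) :
    Tendsto (fun n => orliczDualDist α (ν n) μ) atTop (𝓝 0) := by
  rw [ENNReal.tendsto_nhds_zero]
  intro ε hε
  wlog hεt : ε ≠ ∞ generalizing ε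
  · simp only [ne_eq, not_not] at hεt
    simp [hεt]
  set e := ε.toReal
  have he : 0 < e := ENNReal.toReal_pos hε.ne' hεt
  set C := 8 / s ^ 2 * (M * Real.exp M) with hC
  have hC0 : 0 ≤ C := by positivity
  set t := min (s / 2) (e / (2 * (C + 1))) with htdef
  have ht : 0 < t := by positivity
  have hCt : C * t ≤ e / 2 := by
    have h1 : t ≤ e / (2 * (C + 1)) := min_le_right _ _
    rw [le_div_iff₀ (by positivity)] at h1
    nlinarith
  have hkl' := (ENNReal.tendsto_nhds_zero.1 hkl) (ENNReal.ofReal (t * (e / 2)))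
    (ENNReal.ofReal_pos.2 (by positivity))
  filter_upwards [hν, hkl'] with n ⟨hp, c, hc, hle⟩ hn
  have hH : (InformationTheory.klDiv (ν n) μ).toReal / t ≤ e / 2 := by
    rw [div_le_iff₀ ht, mul_comm]
    exact ENNReal.toReal_le_of_le_ofReal (by positivity) hn
  refine iSup₂_le fun g hg => ?_
  have hgM := hexp g hg.1.1 (lintegral_exp_half_abs_le hg.1 hg.2)
  obtain ⟨hi, hi', h1⟩ := integral_sub_integral_le hc hle hg.1.1 hM hgM ht (min_le_left _ _)
  have hgM' : ∫⁻ x, ENNReal.ofReal (Real.exp (s * |(-g) x|)) ∂μ ≤ ENNReal.ofReal M := by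
    simpa using hgM
  obtain ⟨-, -, h2⟩ := integral_sub_integral_le hc hle hg.1.1.neg hM hgM' ht (min_le_left _ _)
  simp only [Pi.neg_apply, integral_neg] at h2
  rw [if_pos ⟨hi, hi'⟩, ← ENNReal.ofReal_toReal hεt]
  refine ENNReal.ofReal_le_ofReal (abs_le.2 ⟨?_, ?_⟩) <;> linarith

/-! ### Exponential tilting and the `I`-projection -/

section Tilt

variable {E B : Type*} [MeasurableSpace E] [NormedAddCommGroup B] [NormedSpace ℝ B]

lemma lintegral_exp_sub_eq {α : Measure E} [NeZero α] {F : E → B} (l : B →L[ℝ] ℝ)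
    (hl : Integrable (fun x => Real.exp (l (F x))) α) (y : B) :
    ∫⁻ x, ENNReal.ofReal (Real.exp (l (F x - y))) ∂α =
      ENNReal.ofReal (Real.exp (Real.log (∫ x, Real.exp (l (F x)) ∂α) - l y)) := by
  have h1 : ∀ x, Real.exp (l (F x - y)) = Real.exp (-l y) * Real.exp (l (F x)) := fun x => by
    rw [map_sub, ← Real.exp_add]; ring_nf
  simp_rw [h1]
  rw [← ofReal_integral_eq_lintegral_ofReal (hl.const_mul _) (ae_of_all _ fun x => by positivity),
    integral_const_mul, Real.exp_sub, Real.exp_log (integral_exp_pos hl), Real.exp_neg]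
  congr 1
  ring

lemma eventually_add_smul_mem_domLogLaplace {α : Measure E} {F : E → B}
    (hdom : IsOpen (domLogLaplace F α)) {l : B →L[ℝ] ℝ} (hl : l ∈ domLogLaplace F α)
    (f : B →L[ℝ] ℝ) : ∀ᶠ t : ℝ in 𝓝 0, l + t • f ∈ domLogLaplace F α := by
  have hc : Tendsto (fun t : ℝ => l + t • f) (𝓝 0) (𝓝 l) := by
    have : Continuous fun t : ℝ => l + t • f := by fun_prop
    simpa using this.tendsto 0
  exact hc.eventually (hdom.mem_nhds hl)

lemma log_rnDeriv_tilted_eq {α : Measure E} [IsProbabilityMeasure α] {F : E → B}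
    {l : B →L[ℝ] ℝ} (hl : Integrable (fun x => Real.exp (l (F x))) α) :
    llr (α.tilted fun x => l (F x)) α =ᵐ[α.tilted fun x => l (F x)]
      fun x => l (F x) - Real.log (∫ x, Real.exp (l (F x)) ∂α) :=
  (tilted_absolutelyContinuous _ _).ae_le (log_rnDeriv_tilted_left_self hl)

variable [MeasurableSpace B] [BorelSpace B]

lemma mem_domLogLaplace_iff {α : Measure E} {F : E → B} (hF : Measurable F) {l : B →L[ℝ] ℝ} :
    l ∈ domLogLaplace F α ↔ Integrable (fun x => Real.exp (l (F x))) α := by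
  have hm : Measurable fun x => Real.exp (l (F x)) := by fun_prop
  rw [domLogLaplace, Set.mem_ofPred_eq, laplaceTransform, Integrable,
    hasFiniteIntegral_iff_ofReal (ae_of_all _ fun _ => (Real.exp_pos _).le)]
  exact ⟨fun h => ⟨hm.aestronglyMeasurable, h⟩, fun h => h.2⟩

/-- No half-space bounded by a hyperplane through an interior point of the convex hull of the
support has full measure. -/
lemma measure_pos_of_mem_interior_convexHull_support [FiniteDimensional ℝ B] {α : Measure E}
    {F : E → B} (hF : Measurable F) {x₀ : B}
    (hx₀ : x₀ ∈ interior (convexHull ℝ (α.map F).support)) {l : B →L[ℝ] ℝ} (hl : l ≠ 0) :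
    α {x | 0 < l (F x - x₀)} ≠ 0 := by
  intro h0
  have hcl : IsClosed {y : B | l (y - x₀) ≤ 0} := isClosed_le (by fun_prop) continuous_const
  have hsub : (α.map F).support ⊆ {y : B | l (y - x₀) ≤ 0} := by
    refine Measure.support_subset_of_isClosed hcl ?_
    rw [mem_ae_iff, Measure.map_apply hF hcl.measurableSet.compl]
    convert h0 using 2
    ext x; simp
  have hconv : Convex ℝ {y : B | l (y - x₀) ≤ 0} := by
    have : {y : B | l (y - x₀) ≤ 0} = {y : B | l y ≤ l x₀} := by
      ext y; simp
    rw [this]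
    exact convex_halfSpace_le l.toLinearMap.isLinear _
  have hhull := convexHull_min hsub hconv
  obtain ⟨v, hv⟩ : ∃ v, 0 < l v := by
    obtain ⟨v, hv⟩ : ∃ v, l v ≠ 0 := by
      by_contra! h
      exact hl (ContinuousLinearMap.ext h)
    rcases hv.lt_or_gt with h | h
    · exact ⟨-v, by simpa using h⟩
    · exact ⟨v, h⟩
  have hnhds : ∀ᶠ t : ℝ in 𝓝 0, x₀ + t • v ∈ convexHull ℝ (α.map F).support := by
    have hc : Tendsto (fun t : ℝ => x₀ + t • v) (𝓝 0) (𝓝 x₀) := by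
      have : Continuous fun t : ℝ => x₀ + t • v := by fun_prop
      simpa using this.tendsto 0
    exact hc.eventually (mem_interior_iff_mem_nhds.1 hx₀)
  obtain ⟨t, ht, ht0⟩ := ((hnhds.filter_mono nhdsWithin_le_nhds).and
    (self_mem_nhdsWithin (s := Set.Ioi (0 : ℝ)))).exists
  have h1 := hhull ht
  simp only [Set.mem_ofPred_eq, add_sub_cancel_left, map_smul, smul_eq_mul] at h1
  have : 0 < t * l v := mul_pos ht0 hv
  linarith

/-- If no direction is degenerate, then all directions are so uniformly: compactness of the unit
sphere of the dual. -/
lemma exists_uniform_lower_bound [FiniteDimensional ℝ B] {α : Measure E} [IsFiniteMeasure α]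
    {F : E → B} (hF : Measurable F) {x₀ : B}
    (h : ∀ l : B →L[ℝ] ℝ, l ≠ 0 → α {x | 0 < l (F x - x₀)} ≠ 0) :
    ∃ δ : ℝ, 0 < δ ∧ ∀ l : B →L[ℝ] ℝ, ‖l‖ = 1 → δ ≤ ∫ x, min 1 (max 0 (l (F x - x₀))) ∂α := by
  set φ : (B →L[ℝ] ℝ) → ℝ := fun l => ∫ x, min 1 (max 0 (l (F x - x₀))) ∂α
  have hmeas : ∀ l : B →L[ℝ] ℝ, Measurable fun x => min 1 (max 0 (l (F x - x₀))) := fun l => by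
    have : Measurable fun x => l (F x - x₀) := l.continuous.measurable.comp (hF.sub_const _)
    fun_prop
  have hb : ∀ (l : B →L[ℝ] ℝ) x, ‖min 1 (max 0 (l (F x - x₀)))‖ ≤ (1 : ℝ) := fun l x => by
    rw [Real.norm_eq_abs, abs_of_nonneg (by positivity)]
    exact min_le_left _ _
  have hcont : Continuous φ := by
    refine continuous_of_dominated (bound := fun _ => (1 : ℝ))
      (fun l => (hmeas l).aestronglyMeasurable) (fun l => ae_of_all _ (hb l))
      (integrable_const _) (ae_of_all _ fun x => ?_)
    have : Continuous fun l : B →L[ℝ] ℝ => l (F x - x₀) := by fun_prop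
    fun_prop
  have hpos : ∀ l : B →L[ℝ] ℝ, l ≠ 0 → 0 < φ l := fun l hl => by
    have hi : Integrable (fun x => min 1 (max 0 (l (F x - x₀)))) α :=
      (integrable_const (1 : ℝ)).mono' (hmeas l).aestronglyMeasurable (ae_of_all _ (hb l))
    rw [integral_pos_iff_support_of_nonneg (fun x => by positivity) hi]
    refine (pos_iff_ne_zero.2 (h l hl)).trans_le (measure_mono fun x hx => ?_)
    have hx' : 0 < l (F x - x₀) := hx
    have : 0 < min 1 (max 0 (l (F x - x₀))) := lt_min one_pos (hx'.trans_le (le_max_right _ _))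
    exact this.ne'
  rcases (Metric.sphere (0 : B →L[ℝ] ℝ) 1).eq_empty_or_nonempty with he | hne
  · refine ⟨1, one_pos, fun l hl => ?_⟩
    have : l ∈ Metric.sphere (0 : B →L[ℝ] ℝ) 1 := by simpa using hl
    simp [he] at this
  · obtain ⟨l₀, hl₀, hmin⟩ :=
      (isCompact_sphere (0 : B →L[ℝ] ℝ) 1).exists_isMinOn hne hcont.continuousOn
    have hl₀n : ‖l₀‖ = 1 := by simpa using hl₀
    refine ⟨φ l₀, hpos l₀ fun h0 => ?_, fun l hl => hmin (by simpa using hl)⟩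
    simp [h0] at hl₀n

lemma isClosed_lintegral_exp_le {α : Measure E} {F : E → B} (hF : Measurable F) (y : B)
    (c : ℝ≥0∞) :
    IsClosed {l : B →L[ℝ] ℝ | ∫⁻ x, ENNReal.ofReal (Real.exp (l (F x - y))) ∂α ≤ c} := by
  refine IsSeqClosed.isClosed fun u l hu hul => ?_
  have hpt : ∀ x, Tendsto (fun n => ENNReal.ofReal (Real.exp (u n (F x - y)))) atTop
      (𝓝 (ENNReal.ofReal (Real.exp (l (F x - y))))) := fun x => by
    refine ENNReal.tendsto_ofReal ((Real.continuous_exp.tendsto _).comp ?_)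
    have : Continuous fun l : B →L[ℝ] ℝ => l (F x - y) := by fun_prop
    exact (this.tendsto l).comp hul
  have hm : ∀ n, Measurable fun x => ENNReal.ofReal (Real.exp (u n (F x - y))) := fun n => by
    have : Measurable fun x => u n (F x - y) := (u n).continuous.measurable.comp (hF.sub_const _)
    fun_prop
  calc ∫⁻ x, ENNReal.ofReal (Real.exp (l (F x - y))) ∂α
      = ∫⁻ x, liminf (fun n => ENNReal.ofReal (Real.exp (u n (F x - y)))) atTop ∂α := by
        simp_rw [(hpt _).liminf_eq]
    _ ≤ liminf (fun n => ∫⁻ x, ENNReal.ofReal (Real.exp (u n (F x - y))) ∂α) atTop :=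
        lintegral_liminf_le hm
    _ ≤ c := by
        refine liminf_le_of_le ?_ fun b hb => ?_
        · isBoundedDefault
        · obtain ⟨n, hn⟩ := hb.exists
          exact hn.trans (hu n)

/-- The dual problem has a solution: `l` minimizes `sup_{y ∈ K} (Λ_F(l) - ⟨l, y⟩)`. Minimality is
expressed through the upper bounds of `y ↦ Λ_F(l) - ⟨l, y⟩` on `K`. -/
lemma exists_dual_minimizer [FiniteDimensional ℝ B] {α : Measure E} [IsProbabilityMeasure α]
    {F : E → B} (hF : Measurable F) {K : Set B} {x₀ : B} (hx₀K : x₀ ∈ K)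
    (h : ∀ l : B →L[ℝ] ℝ, l ≠ 0 → α {x | 0 < l (F x - x₀)} ≠ 0) :
    ∃ l ∈ domLogLaplace F α, ∀ l' ∈ domLogLaplace F α, ∀ r : ℝ,
      (∀ y ∈ K, Real.log (∫ x, Real.exp (l' (F x)) ∂α) - l' y ≤ r) →
      ∀ y ∈ K, Real.log (∫ x, Real.exp (l (F x)) ∂α) - l y ≤ r := by
  set ψ : (B →L[ℝ] ℝ) → ℝ≥0∞ :=
    fun l => ⨆ y ∈ K, ∫⁻ x, ENNReal.ofReal (Real.exp (l (F x - y))) ∂α with hψ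
  obtain ⟨δ, hδ, hδl⟩ := exists_uniform_lower_bound hF h
  have hψ0 : ψ 0 ≤ 1 := by simp [hψ]
  -- Coercivity, from `r * min 1 (max 0 u) ≤ exp (r * u)`.
  have hcoer : ∀ l : B →L[ℝ] ℝ, ENNReal.ofReal (‖l‖ * δ) ≤ ψ l := fun l => by
    rcases eq_or_ne l 0 with rfl | hl0
    · simp
    have hn : 0 < ‖l‖ := norm_pos_iff.2 hl0
    set u : B →L[ℝ] ℝ := ‖l‖⁻¹ • l
    have hu : ‖u‖ = 1 := by simp [u, norm_smul, hn.ne']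
    have hlu : ∀ z, l z = ‖l‖ * u z := fun z => by simp [u, hn.ne']
    have hm : Measurable fun x => min 1 (max 0 (u (F x - x₀))) := by
      have : Measurable fun x => u (F x - x₀) := u.continuous.measurable.comp (hF.sub_const _)
      fun_prop
    calc ENNReal.ofReal (‖l‖ * δ)
        ≤ ENNReal.ofReal (∫ x, ‖l‖ * min 1 (max 0 (u (F x - x₀))) ∂α) := by
          rw [integral_const_mul]
          exact ENNReal.ofReal_le_ofReal (by gcongr; exact hδl u hu)
      _ ≤ ∫⁻ x, ENNReal.ofReal (‖l‖ * min 1 (max 0 (u (F x - x₀)))) ∂α := by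
          rw [integral_eq_lintegral_of_nonneg_ae (ae_of_all _ fun x => by positivity)
            (by fun_prop)]
          exact ENNReal.ofReal_toReal_le
      _ ≤ ∫⁻ x, ENNReal.ofReal (Real.exp (l (F x - x₀))) ∂α := by
          refine lintegral_mono fun x => ENNReal.ofReal_le_ofReal ?_
          rw [hlu]
          set w := u (F x - x₀)
          rcases le_total w 0 with hw | hw
          · rw [max_eq_left hw]; simp [(Real.exp_pos _).le]
          · rw [max_eq_right hw]
            have h1 := Real.add_one_le_exp (‖l‖ * w)
            have h2 : ‖l‖ * min 1 w ≤ ‖l‖ * w := by gcongr; exact min_le_right _ _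
            linarith
      _ ≤ ψ l := le_iSup₂_of_le x₀ hx₀K le_rfl
  have hlsc : LowerSemicontinuous ψ := by
    refine lowerSemicontinuous_biSup fun y _ => ?_
    exact lowerSemicontinuous_iff_isClosed_preimage.2 fun c => isClosed_lintegral_exp_le hF y c
  obtain ⟨l, -, hmin⟩ := LowerSemicontinuousOn.exists_isMinOn
    (s := Metric.closedBall (0 : B →L[ℝ] ℝ) (2 / δ)) ⟨0, by simp; positivity⟩
    (isCompact_closedBall _ _) (hlsc.lowerSemicontinuousOn _)
  have hmin0 : ψ l ≤ ψ 0 := hmin (by simp; positivity)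
  have hglob : ∀ l', ψ l ≤ ψ l' := fun l' => by
    by_cases hl' : l' ∈ Metric.closedBall (0 : B →L[ℝ] ℝ) (2 / δ)
    · exact hmin hl'
    · have h1 : 2 / δ < ‖l'‖ := by simpa using hl'
      rw [div_lt_iff₀ hδ] at h1
      refine (hmin0.trans hψ0).trans (le_trans ?_ (hcoer l'))
      rw [← ENNReal.ofReal_one]
      exact ENNReal.ofReal_le_ofReal (by linarith)
  have hldom : Integrable (fun x => Real.exp (l (F x))) α := by
    have hm : Measurable fun x => Real.exp (l (F x)) := by fun_prop
    refine ⟨hm.aestronglyMeasurable, ?_⟩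
    rw [hasFiniteIntegral_iff_ofReal (ae_of_all _ fun _ => (Real.exp_pos _).le)]
    have h1 : ∀ x, ENNReal.ofReal (Real.exp (l (F x))) =
        ENNReal.ofReal (Real.exp (l x₀)) * ENNReal.ofReal (Real.exp (l (F x - x₀))) := fun x => by
      rw [← ENNReal.ofReal_mul (Real.exp_pos _).le, ← Real.exp_add]; simp
    simp_rw [h1]
    rw [lintegral_const_mul' _ _ ENNReal.ofReal_ne_top]
    refine ENNReal.mul_lt_top ENNReal.ofReal_lt_top ?_
    exact ((le_iSup₂_of_le x₀ hx₀K le_rfl).trans (hmin0.trans hψ0)).trans_lt ENNReal.one_lt_top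
  refine ⟨l, (mem_domLogLaplace_iff hF).2 hldom, fun l' hl' r hr y hy => ?_⟩
  have hl'i := (mem_domLogLaplace_iff hF).1 hl'
  have h1 : ψ l' ≤ ENNReal.ofReal (Real.exp r) := by
    refine iSup₂_le fun y hy => ?_
    rw [lintegral_exp_sub_eq l' hl'i]
    exact ENNReal.ofReal_le_ofReal (Real.exp_le_exp.2 (hr y hy))
  have h2 := (le_iSup₂_of_le y hy le_rfl).trans ((hglob l').trans h1)
  rw [lintegral_exp_sub_eq l hldom] at h2
  rwa [ENNReal.ofReal_le_ofReal_iff (Real.exp_pos _).le, Real.exp_le_exp] at h2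

lemma integrable_exp_mul_tilted {α : Measure E} [NeZero α] {F : E → B} (hF : Measurable F)
    {l f : B →L[ℝ] ℝ} (hl : l ∈ domLogLaplace F α) {t : ℝ}
    (ht : l + t • f ∈ domLogLaplace F α) :
    Integrable (fun x => Real.exp (t * f (F x))) (α.tilted fun x => l (F x)) := by
  rw [integrable_tilted_iff ((mem_domLogLaplace_iff hF).1 hl)]
  refine ((mem_domLogLaplace_iff hF).1 ht).congr (ae_of_all _ fun x => ?_)
  simp [Real.exp_add]

lemma zero_mem_interior_integrableExpSet_tilted {α : Measure E} [NeZero α] {F : E → B}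
    (hF : Measurable F) (hdom : IsOpen (domLogLaplace F α)) {l : B →L[ℝ] ℝ}
    (hl : l ∈ domLogLaplace F α) (f : B →L[ℝ] ℝ) :
    0 ∈ interior (integrableExpSet (fun x => f (F x)) (α.tilted fun x => l (F x))) := by
  rw [mem_interior_iff_mem_nhds]
  filter_upwards [eventually_add_smul_mem_domLogLaplace hdom hl f] with t ht
  exact integrable_exp_mul_tilted hF hl ht

lemma memLp_tilted [FiniteDimensional ℝ B] {α : Measure E} [NeZero α] {F : E → B}
    (hF : Measurable F) (hdom : IsOpen (domLogLaplace F α)) {l : B →L[ℝ] ℝ}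
    (hl : l ∈ domLogLaplace F α) (p : NNReal) : MemLp F p (α.tilted fun x => l (F x)) := by
  set b := Module.finBasis ℝ B
  have h1 : ∀ i, MemLp (fun x => (b.coord i).toContinuousLinearMap (F x)) p
      (α.tilted fun x => l (F x)) := fun i =>
    memLp_of_mem_interior_integrableExpSet
      (zero_mem_interior_integrableExpSet_tilted hF hdom hl _) p
  have h2 : F = fun x => ∑ i, (b.coord i).toContinuousLinearMap (F x) • b i := by
    funext x
    simp
  rw [h2]
  refine memLp_finsetSum _ fun i _ => ?_
  have := (ContinuousLinearMap.toSpanSingleton ℝ (b i)).comp_memLp' (h1 i)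
  simpa [Function.comp_def] using this

/-- The gradient of `Λ_F` at `l` is the mean of `F` under the tilted measure. -/
lemma tendsto_slope_logLaplace [FiniteDimensional ℝ B] {α : Measure E} [IsProbabilityMeasure α]
    {F : E → B} (hF : Measurable F) (hdom : IsOpen (domLogLaplace F α)) {l : B →L[ℝ] ℝ}
    (hl : l ∈ domLogLaplace F α) (f : B →L[ℝ] ℝ) :
    Tendsto (fun t : ℝ => t⁻¹ * (Real.log (∫ x, Real.exp ((l + t • f) (F x)) ∂α) -
      Real.log (∫ x, Real.exp (l (F x)) ∂α))) (𝓝[>] 0)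
      (𝓝 (f (∫ x, F x ∂(α.tilted fun x => l (F x))))) := by
  have hli := (mem_domLogLaplace_iff hF).1 hl
  set β := α.tilted fun x => l (F x)
  have hβ : IsProbabilityMeasure β := isProbabilityMeasure_tilted hli
  have h0 := zero_mem_interior_integrableExpSet_tilted hF hdom hl f
  have hd : HasDerivAt (cgf (fun x => f (F x)) β) (f (∫ x, F x ∂β)) 0 := by
    have h1 := (analyticAt_cgf h0).differentiableAt.hasDerivAt
    rw [deriv_cgf_zero h0] at h1
    have h2 : Integrable F β := (memLp_tilted hF hdom hl 1).integrable le_rfl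
    rw [← ContinuousLinearMap.integral_comp_comm f h2]
    simpa using h1
  have h3 := hd.tendsto_slope_zero_right
  refine h3.congr' ?_
  have hev := (eventually_add_smul_mem_domLogLaplace hdom hl f).filter_mono
    (nhdsWithin_le_nhds (s := Set.Ioi 0))
  filter_upwards [hev] with t ht
  have hti := (mem_domLogLaplace_iff hF).1 ht
  have h4 : cgf (fun x => f (F x)) β t = Real.log (∫ x, Real.exp ((l + t • f) (F x)) ∂α) -
      Real.log (∫ x, Real.exp (l (F x)) ∂α) := by
    rw [cgf, mgf, integral_exp_tilted, Real.log_div (integral_exp_pos ?_).ne'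
      (integral_exp_pos hli).ne']
    · simp
    · simpa using hti
  simp [h4, cgf_zero]

/-- The exponential tilting that solves the dual problem has its mean in `K`, and its
parameter is minimized over `K` at that mean. -/
lemma exists_tilt [FiniteDimensional ℝ B] {α : Measure E} [IsProbabilityMeasure α]
    {F : E → B} (hF : Measurable F) (hdom : IsOpen (domLogLaplace F α)) {K : Set B}
    (hKclosed : IsClosed K) (hKconv : Convex ℝ K) {x₀ : B} (hx₀K : x₀ ∈ K)
    (h : ∀ l : B →L[ℝ] ℝ, l ≠ 0 → α {x | 0 < l (F x - x₀)} ≠ 0) :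
    ∃ l ∈ domLogLaplace F α, ∫ x, F x ∂(α.tilted fun x => l (F x)) ∈ K ∧
      ∀ y ∈ K, l (∫ x, F x ∂(α.tilted fun x => l (F x))) ≤ l y := by
  obtain ⟨l, hl, hmin⟩ := exists_dual_minimizer hF hx₀K h
  refine ⟨l, hl, ?_⟩
  set Λ : (B →L[ℝ] ℝ) → ℝ := fun l => Real.log (∫ x, Real.exp (l (F x)) ∂α) with hΛ
  set m := ∫ x, F x ∂(α.tilted fun x => l (F x)) with hm
  have hbdd : BddAbove ((fun y => Λ l - l y) '' K) := by
    refine ⟨0, ?_⟩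
    rintro _ ⟨y, hy, rfl⟩
    refine hmin 0 ?_ 0 (by simp) y hy
    rw [mem_domLogLaplace_iff hF]; simp
  set S := sSup ((fun y => Λ l - l y) '' K)
  have hS : ∀ y ∈ K, Λ l - l y ≤ S := fun y hy => le_csSup hbdd ⟨y, hy, rfl⟩
  have hSle : ∀ r, (∀ y ∈ K, Λ l - l y ≤ r) → S ≤ r := fun r hr =>
    csSup_le ⟨_, x₀, hx₀K, rfl⟩ (by rintro _ ⟨y, hy, rfl⟩; exact hr y hy)
  have hev : ∀ f : B →L[ℝ] ℝ, ∀ᶠ t : ℝ in 𝓝[>] 0, l + t • f ∈ domLogLaplace F α := fun f =>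
    (eventually_add_smul_mem_domLogLaplace hdom hl f).filter_mono nhdsWithin_le_nhds
  constructor
  · -- Otherwise moving `l` in a direction separating `m` from `K` would decrease the dual value.
    by_contra hmK
    obtain ⟨f, u, hfm, hfu⟩ := geometric_hahn_banach_point_closed hKconv hKclosed hmK
    refine hfm.not_ge (ge_of_tendsto (tendsto_slope_logLaplace hF hdom hl f) ?_)
    filter_upwards [hev f, self_mem_nhdsWithin] with t ht (ht0 : 0 < t)
    have h1 := hSle _ (hmin (l + t • f) ht (Λ (l + t • f) - Λ l + S - t * u) fun y hy => ?_)
    · rw [inv_mul_eq_div, le_div_iff₀ ht0]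
      linarith
    · have h2 := hS y hy
      have h3 : t * u ≤ t * f y := by gcongr; exact (hfu y hy).le
      simp only [add_apply, smul_apply, smul_eq_mul,
        hΛ] at *
      linarith
  · -- Here `l` is moved towards `0`.
    intro y₀ hy₀
    have hlim := tendsto_slope_logLaplace hF hdom hl (-l)
    have h1 : S - Λ l ≤ (-l) m := by
      refine ge_of_tendsto hlim ?_
      have h01 : ∀ᶠ t : ℝ in 𝓝[>] 0, t < 1 :=
        (eventually_lt_nhds one_pos).filter_mono nhdsWithin_le_nhds
      filter_upwards [hev (-l), self_mem_nhdsWithin, h01] with t ht (ht0 : 0 < t) ht1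
      have h1 := hSle _ (hmin (l + t • (-l)) ht
        (Λ (l + t • (-l)) - Λ l + t * Λ l + (1 - t) * S) fun y hy => ?_)
      · rw [inv_mul_eq_div, le_div_iff₀ ht0]
        simp only [hΛ] at *
        linarith
      · have h2 := mul_le_mul_of_nonneg_left (hS y hy) (sub_nonneg.2 ht1.le)
        have h3 : (l + t • (-l)) y = (1 - t) * l y := by
          simp; ring
        rw [h3]
        simp only [hΛ] at *
        linarith
    have h2 := hS y₀ hy₀
    simp only [neg_apply] at h1
    linarith

/-- The Pythagorean inequality of `I`-projections: the parameter of the tilting is minimized over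
`K` at the mean of the tilted measure. -/
lemma klDiv_add_klDiv_tilted_le [FiniteDimensional ℝ B] {α : Measure E} [IsProbabilityMeasure α]
    {F : E → B} (hF : Measurable F) (hdom : IsOpen (domLogLaplace F α)) {K : Set B}
    {l : B →L[ℝ] ℝ} (hl : l ∈ domLogLaplace F α)
    (hmin : ∀ y ∈ K, l (∫ x, F x ∂(α.tilted fun x => l (F x))) ≤ l y)
    {ν : Measure E} (hν : ν ∈ momentConstraint F K) :
    InformationTheory.klDiv ν (α.tilted fun x => l (F x)) +
      InformationTheory.klDiv (α.tilted fun x => l (F x)) α ≤ InformationTheory.klDiv ν α := by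
  obtain ⟨hνp, hνF, hνK⟩ := hν
  have hli := (mem_domLogLaplace_iff hF).1 hl
  by_cases hfin : InformationTheory.klDiv ν α = ∞
  · simp [hfin]
  obtain ⟨hac, hint⟩ := InformationTheory.klDiv_ne_top_iff.1 hfin
  set β := α.tilted fun x => l (F x)
  have hβ : IsProbabilityMeasure β := isProbabilityMeasure_tilted hli
  have hβF : Integrable F β := (memLp_tilted hF hdom hl 1).integrable le_rfl
  have hβα : β ≪ α := tilted_absolutelyContinuous _ _
  have hνβ : ν ≪ β := hac.trans (absolutelyContinuous_tilted hli)
  have hlν : Integrable (fun x => l (F x)) ν := l.integrable_comp hνF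
  have hlβ : Integrable (fun x => l (F x)) β := l.integrable_comp hβF
  have hint1 := integrable_llr_tilted_right hac hlν hint hli
  have hllr := log_rnDeriv_tilted_eq (F := F) hli
  have hint2 : Integrable (llr β α) β :=
    (integrable_congr hllr).2 (hlβ.sub (integrable_const _))
  have hne1 := InformationTheory.klDiv_ne_top hνβ hint1
  have hne2 := InformationTheory.klDiv_ne_top hβα hint2
  rw [← ENNReal.toReal_le_toReal (ENNReal.add_ne_top.2 ⟨hne1, hne2⟩) hfin,
    ENNReal.toReal_add hne1 hne2, InformationTheory.toReal_klDiv_of_measure_eq hνβ (by simp),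
    InformationTheory.toReal_klDiv_of_measure_eq hβα (by simp),
    InformationTheory.toReal_klDiv_of_measure_eq hac (by simp),
    integral_llr_tilted_right hac hlν hli hint, integral_congr_ae hllr,
    integral_sub hlβ (integrable_const _), l.integral_comp_comm hνF, l.integral_comp_comm hβF]
  have := hmin _ hνK
  simp only [integral_const, probReal_univ, one_smul]
  linarith

lemma isIProjection_tilted [FiniteDimensional ℝ B] {α : Measure E} [IsProbabilityMeasure α]
    {F : E → B} (hF : Measurable F) (hdom : IsOpen (domLogLaplace F α)) {K : Set B}
    {l : B →L[ℝ] ℝ} (hl : l ∈ domLogLaplace F α)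
    (hmK : ∫ x, F x ∂(α.tilted fun x => l (F x)) ∈ K)
    (hmin : ∀ y ∈ K, l (∫ x, F x ∂(α.tilted fun x => l (F x))) ≤ l y) :
    IsIProjection α (momentConstraint F K) (α.tilted fun x => l (F x)) ∧
      ∀ β, IsIProjection α (momentConstraint F K) β → β = α.tilted fun x => l (F x) := by
  have hli := (mem_domLogLaplace_iff hF).1 hl
  have hprob : IsProbabilityMeasure (α.tilted fun x => l (F x)) := isProbabilityMeasure_tilted hli
  have hint : Integrable F (α.tilted fun x => l (F x)) :=
    (memLp_tilted hF hdom hl 1).integrable le_rfl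
  have hmem : (α.tilted fun x => l (F x)) ∈ momentConstraint F K := ⟨hprob, hint, hmK⟩
  have hfin : InformationTheory.klDiv (α.tilted fun x => l (F x)) α ≠ ∞ := by
    refine InformationTheory.klDiv_ne_top (tilted_absolutelyContinuous _ _) ?_
    exact (integrable_congr (log_rnDeriv_tilted_eq hli)).2
      ((l.integrable_comp hint).sub (integrable_const _))
  refine ⟨⟨hmem, hfin.lt_top, fun ν hν => ?_⟩, fun β hβ => ?_⟩
  · exact le_add_self.trans (klDiv_add_klDiv_tilted_le hF hdom hl hmin hν)
  · have h1 := klDiv_add_klDiv_tilted_le hF hdom hl hmin hβ.1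
    have h2 := h1.trans (hβ.2.2 _ hmem)
    have h3 : InformationTheory.klDiv β (α.tilted fun x => l (F x)) = 0 := by
      by_contra h0
      exact (ENNReal.lt_add_right hfin h0).not_ge (by rwa [add_comm] at h2)
    have hβp : IsProbabilityMeasure β := hβ.1.1
    exact InformationTheory.klDiv_eq_zero_iff.1 h3

/-- Non-degeneracy passes from `α` to a tilted measure, centred at its mean. -/
lemma measure_pos_tilted [FiniteDimensional ℝ B] {α : Measure E} [IsProbabilityMeasure α]
    {F : E → B} (hF : Measurable F) (hdom : IsOpen (domLogLaplace F α)) {l : B →L[ℝ] ℝ}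
    (hl : l ∈ domLogLaplace F α) {x₀ : B}
    (h : ∀ f : B →L[ℝ] ℝ, f ≠ 0 → α {x | 0 < f (F x - x₀)} ≠ 0)
    {f : B →L[ℝ] ℝ} (hf : f ≠ 0) :
    (α.tilted fun x => l (F x)) {x | 0 < f (F x - ∫ y, F y ∂(α.tilted fun x => l (F x)))} ≠ 0 := by
  have hli := (mem_domLogLaplace_iff hF).1 hl
  set β := α.tilted fun x => l (F x)
  have hβ : IsProbabilityMeasure β := isProbabilityMeasure_tilted hli
  have hβF : Integrable F β := (memLp_tilted hF hdom hl 1).integrable le_rfl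
  have hαβ : α ≪ β := absolutelyContinuous_tilted hli
  set m := ∫ y, F y ∂β with hm
  intro h0
  have hle : ∀ᵐ x ∂β, 0 ≤ -f (F x - m) := by
    rw [ae_iff]
    convert h0 using 3
    simp
  have hint : Integrable (fun x => -f (F x - m)) β :=
    (f.integrable_comp (hβF.sub (integrable_const m))).neg
  have hzero : ∫ x, -f (F x - m) ∂β = 0 := by
    simp_rw [map_sub]
    rw [integral_neg, integral_sub (f.integrable_comp hβF) (integrable_const _),
      f.integral_comp_comm hβF]
    simp [← hm]
  have hae : ∀ᵐ x ∂α, f (F x - x₀) = f (m - x₀) := by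
    refine hαβ.ae_le ?_
    filter_upwards [(integral_eq_zero_iff_of_nonneg_ae hle hint).1 hzero] with x hx
    simp only [map_sub, Pi.zero_apply, neg_eq_zero] at hx ⊢
    linarith
  rcases le_total (f (m - x₀)) 0 with hs | hs
  · refine h f hf (measure_mono_null (fun x hx => ?_) (ae_iff.1 hae))
    intro hx'
    have hx : 0 < f (F x - x₀) := hx
    linarith
  · refine h (-f) (neg_ne_zero.2 hf) (measure_mono_null (fun x hx => ?_) (ae_iff.1 hae))
    intro hx'
    have hx : 0 < (-f) (F x - x₀) := hx
    rw [neg_apply] at hx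
    linarith

end Tilt

/-! ### A subexponential small-ball estimate for sums of i.i.d. vectors -/

section SmallBall

variable {B : Type*} [NormedAddCommGroup B] [NormedSpace ℝ B] [MeasurableSpace B] [BorelSpace B]

/-- One step of a non-degenerate walk started in a large Euclidean ball stays in that ball with a
probability that is bounded below: some direction of the step points inwards. -/
lemma exists_ball_step [FiniteDimensional ℝ B] {μ : Measure B} [IsProbabilityMeasure μ]
    (h : ∀ f : B →L[ℝ] ℝ, f ≠ 0 → μ {z | 0 < f z} ≠ 0) :
    ∃ R p : ℝ, 0 < R ∧ 0 < p ∧ p ≤ 1 ∧ ∀ s : B, ‖toEuclidean s‖ ≤ R →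
      p ≤ μ.real {z | ‖toEuclidean (s + z)‖ ≤ R} := by
  set L : B ≃L[ℝ] EuclideanSpace ℝ (Fin (Module.finrank ℝ B)) := toEuclidean
  have hLm : Measurable fun z => L z := L.continuous.measurable
  obtain ⟨δ', hδ', hδl⟩ := exists_uniform_lower_bound (α := μ) (F := fun z => L z) (x₀ := 0) hLm
    (fun l hl => by
      have := h (l.comp (L : B →L[ℝ] _)) fun h0 => hl <| ContinuousLinearMap.ext fun y => by
        simpa using congrArg (fun f : B →L[ℝ] ℝ => f (L.symm y)) h0
      simpa using this)
  set δ := min δ' 1 with hδdef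
  have hδ : 0 < δ := lt_min hδ' one_pos
  have hδ1 : δ ≤ 1 := min_le_right _ _
  -- Truncation of the steps at a level `M` costs probability at most `δ / 4`.
  obtain ⟨M, hM0, hM⟩ : ∃ M : ℝ, 0 < M ∧ μ.real {z | M < ‖L z‖} ≤ δ / 4 := by
    have hanti : Antitone fun n : ℕ => {z : B | (n : ℝ) < ‖L z‖} := fun i j hij z hz => by
      have h1 : (j : ℝ) < ‖L z‖ := hz
      exact lt_of_le_of_lt (by exact_mod_cast hij) h1
    have hmeas : ∀ n : ℕ, MeasurableSet {z : B | (n : ℝ) < ‖L z‖} := fun n =>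
      measurableSet_lt measurable_const hLm.norm
    have hlim := tendsto_measure_iInter_atTop (μ := μ) (fun n => (hmeas n).nullMeasurableSet)
      hanti ⟨0, measure_ne_top _ _⟩
    have hempty : ⋂ n : ℕ, {z : B | (n : ℝ) < ‖L z‖} = ∅ := by
      refine Set.eq_empty_of_forall_notMem fun z hz => ?_
      obtain ⟨n, hn⟩ := exists_nat_ge ‖L z‖
      have h1 : (n : ℝ) < ‖L z‖ := Set.mem_iInter.1 hz n
      linarith
    rw [hempty, measure_empty] at hlim
    have hev := hlim.eventually (gt_mem_nhds (ENNReal.ofReal_pos.2 (by positivity : 0 < δ / 4)))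
    obtain ⟨n, hn, hn1⟩ := (hev.and (eventually_ge_atTop 1)).exists
    exact ⟨n, by exact_mod_cast hn1, ENNReal.toReal_le_of_le_ofReal (by positivity) hn.le⟩
  set R := max (2 * M) (2 * M ^ 2 / δ)
  have hR1 : 2 * M ≤ R := le_max_left _ _
  have hR2 : 2 * M ^ 2 ≤ R * δ := by
    rw [← div_le_iff₀ hδ]; exact le_max_right _ _
  refine ⟨R, δ / 4, by linarith, by positivity, by linarith, fun s hs => ?_⟩
  have hMset : MeasurableSet {z : B | M < ‖L z‖} := measurableSet_lt measurable_const hLm.norm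
  rcases lt_or_ge ‖L s‖ (R / 2) with hsmall | hbig
  · have h1 : {z : B | M < ‖L z‖}ᶜ ⊆ {z | ‖L (s + z)‖ ≤ R} := fun z hz => by
      have hz' : ‖L z‖ ≤ M := not_lt.1 hz
      have : ‖L (s + z)‖ ≤ ‖L s‖ + ‖L z‖ := by rw [map_add]; exact norm_add_le _ _
      exact this.trans (by linarith)
    refine le_trans ?_ (measureReal_mono h1)
    rw [probReal_compl_eq_one_sub hMset]
    linarith
  · have hpos : 0 < ‖L s‖ := by linarith
    set u := -(‖L s‖⁻¹ • L s) with hu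
    have hun : ‖u‖ = 1 := by rw [hu, norm_neg, norm_smul]; simp [hpos.ne']
    have hLs : L s = -(‖L s‖ • u) := by rw [hu]; simp [smul_smul, hpos.ne']
    have hW := hδl (innerSL ℝ u) (by rw [innerSL_apply_norm, hun])
    simp only [sub_zero, innerSL_apply_apply] at hW
    have hWm : Measurable fun z => inner ℝ u (L z) := by fun_prop
    set T := {z : B | δ / 2 < inner ℝ u (L z)}
    have hT : MeasurableSet T := measurableSet_lt measurable_const hWm
    have hTle : δ / 2 ≤ μ.real T := by
      have h2 : ∫ z, min 1 (max 0 (inner ℝ u (L z))) ∂μ ≤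
          ∫ z, (δ / 2 + T.indicator (fun _ => (1 : ℝ)) z) ∂μ := by
        refine integral_mono ?_ ?_ fun z => ?_
        · refine (integrable_const (1 : ℝ)).mono' (by fun_prop) (ae_of_all _ fun z => ?_)
          rw [Real.norm_eq_abs, abs_of_nonneg (by positivity)]
          exact min_le_left _ _
        · exact (integrable_const _).add ((integrable_const _).indicator hT)
        · by_cases hz : z ∈ T
          · simp only [Set.indicator_of_mem hz]
            exact (min_le_left _ _).trans (by linarith)
          · simp only [Set.indicator_of_notMem hz, add_zero]
            exact (min_le_right _ _).trans (max_le (by positivity) (not_lt.1 hz))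
      rw [integral_add (integrable_const _) ((integrable_const _).indicator hT),
        integral_indicator_const _ hT] at h2
      simp only [integral_const, probReal_univ, smul_eq_mul, mul_one] at h2
      have h3 : δ ≤ δ' := min_le_left _ _
      linarith
    have hsub : T \ {z : B | M < ‖L z‖} ⊆ {z | ‖L (s + z)‖ ≤ R} := by
      rintro z ⟨hz1, hz2⟩
      have hz1' : δ / 2 < inner ℝ u (L z) := hz1
      have hz2' : ‖L z‖ ≤ M := not_lt.1 hz2
      have h4 : ‖L (s + z)‖ ^ 2 = ‖L s‖ ^ 2 - 2 * (‖L s‖ * inner ℝ u (L z)) + ‖L z‖ ^ 2 := by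
        rw [map_add, norm_add_sq_real]
        conv_lhs => rw [hLs]
        simp only [norm_neg, inner_neg_left, real_inner_smul_left, norm_smul, hun, norm_norm]
        ring
      have hs' : ‖L s‖ ≤ R := hs
      have h5 : ‖L (s + z)‖ ^ 2 ≤ R ^ 2 := by
        rw [h4]
        have h6 : ‖L z‖ ^ 2 ≤ M ^ 2 := by gcongr
        have h7 : ‖L s‖ * (δ / 2) ≤ ‖L s‖ * inner ℝ u (L z) := by gcongr
        have h8 : R / 2 * δ ≤ ‖L s‖ * δ := by gcongr
        have h9 : ‖L s‖ ^ 2 ≤ R ^ 2 := by gcongr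
        nlinarith
      exact abs_le_of_sq_le_sq' h5 (by linarith) |>.2
    refine le_trans ?_ (measureReal_mono hsub)
    have h10 := le_measureReal_sdiff (μ := μ) (s₁ := T) (s₂ := {z : B | M < ‖L z‖})
    linarith

variable {Ω : Type*} [MeasurableSpace Ω] {P : Measure Ω}

/-- Iterating `exists_ball_step`: the walk stays in the ball for `k` steps with probability
at least `p ^ k`. -/
lemma pow_le_measure_sum_Ico [FiniteDimensional ℝ B] [IsProbabilityMeasure P] {μ : Measure B}
    [IsProbabilityMeasure μ] {Z : ℕ → Ω → B} (hZm : ∀ i, Measurable (Z i)) (hZ : iIndepFun Z P)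
    (hlaw : ∀ i, P.map (Z i) = μ) {R p : ℝ} (hR : 0 < R) (hp : 0 ≤ p)
    (hstep : ∀ s : B, ‖toEuclidean s‖ ≤ R → p ≤ μ.real {z | ‖toEuclidean (s + z)‖ ≤ R})
    (j k : ℕ) :
    p ^ k ≤ P.real {ω | ‖toEuclidean (∑ i ∈ Finset.Ico j (j + k), Z i ω)‖ ≤ R} := by
  induction k with
  | zero => simp [hR.le]
  | succ k ih =>
    set L : B ≃L[ℝ] EuclideanSpace ℝ (Fin (Module.finrank ℝ B)) := toEuclidean
    set W : Ω → B := fun ω => ∑ i ∈ Finset.Ico j (j + k), Z i ω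
    have hWm : Measurable W := Finset.measurable_sum _ fun i _ => hZm i
    have hW : IndepFun W (Z (j + k)) P := by
      have h1 := hZ.indepFun_finsetSum_of_notMem hZm (s := Finset.Ico j (j + k)) (i := j + k)
        (by simp)
      convert h1 using 1
      funext ω; simp [W]
    have hprod := (indepFun_iff_map_prod_eq_prod_map_map hWm.aemeasurable
      (hZm _).aemeasurable).1 hW
    have hcl : MeasurableSet {q : B × B | ‖L (q.1 + q.2)‖ ≤ R} :=
      (isClosed_le (by fun_prop) continuous_const).measurableSet
    have hclW : MeasurableSet {w : B | ‖L w‖ ≤ R} :=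
      (isClosed_le (by fun_prop) continuous_const).measurableSet
    have hset : {ω | ‖L (∑ i ∈ Finset.Ico j (j + (k + 1)), Z i ω)‖ ≤ R} =
        (fun ω => (W ω, Z (j + k) ω)) ⁻¹' {q : B × B | ‖L (q.1 + q.2)‖ ≤ R} := by
      ext ω
      simp only [Set.mem_ofPred_eq, Set.mem_preimage, W]
      rw [← add_assoc, Finset.sum_Ico_succ_top (by omega)]
    have hWprob : IsProbabilityMeasure (P.map W) :=
      Measure.isProbabilityMeasure_map hWm.aemeasurable
    have hge : ENNReal.ofReal p * P {ω | ‖L (W ω)‖ ≤ R} ≤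
        P {ω | ‖L (∑ i ∈ Finset.Ico j (j + (k + 1)), Z i ω)‖ ≤ R} := by
      rw [hset, ← Measure.map_apply (hWm.prodMk (hZm _)) hcl, hprod, hlaw,
        Measure.prod_apply hcl]
      calc ENNReal.ofReal p * P {ω | ‖L (W ω)‖ ≤ R}
          = ∫⁻ _ in {w : B | ‖L w‖ ≤ R}, ENNReal.ofReal p ∂(P.map W) := by
            rw [setLIntegral_const, Measure.map_apply hWm hclW]; rfl
        _ ≤ ∫⁻ w in {w : B | ‖L w‖ ≤ R},
              μ (Prod.mk w ⁻¹' {q : B × B | ‖L (q.1 + q.2)‖ ≤ R}) ∂(P.map W) := by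
            refine setLIntegral_mono' hclW fun w hw => ?_
            exact (ENNReal.ofReal_le_ofReal (hstep w hw)).trans_eq (ofReal_measureReal)
        _ ≤ _ := setLIntegral_le_lintegral _ _
    rw [pow_succ, mul_comm]
    have h2 := ENNReal.toReal_mono (measure_ne_top _ _) hge
    rw [ENNReal.toReal_mul, ENNReal.toReal_ofReal hp] at h2
    exact (mul_le_mul_of_nonneg_left ih hp).trans h2

/-- The law of the first coordinates of an i.i.d. sequence. -/
lemma map_fin_eq_pi {E : Type*} [MeasurableSpace E] [IsProbabilityMeasure P] {μ : Measure E}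
    {X : ℕ → Ω → E} (hXm : ∀ i, Measurable (X i)) (hX : iIndepFun X P)
    (hlaw : ∀ i, P.map (X i) = μ) (n : ℕ) :
    P.map (fun ω (i : Fin n) => X i ω) = Measure.pi fun _ : Fin n => μ := by
  have h1 : iIndepFun (fun (i : Fin n) => X i) P := hX.precomp Fin.val_injective
  rw [(iIndepFun_iff_map_fun_eq_pi_map fun i => (hXm _).aemeasurable).1 h1]
  simp [hlaw]

/-- The type 2 inequality without the normalization of the variance. -/
lemma integral_norm_sum_sq_le [FiniteDimensional ℝ B] [IsProbabilityMeasure P] {μ : Measure B}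
    [IsProbabilityMeasure μ] (hμ2 : MemLp (fun z : B => z) 2 μ) (hμ0 : ∫ z, z ∂μ = 0)
    {Z : ℕ → Ω → B} (hZm : ∀ i, Measurable (Z i)) (hZ : iIndepFun Z P)
    (hlaw : ∀ i, P.map (Z i) = μ) {a : ℝ} (ha : IsTypeTwoConst B a) (n : ℕ) :
    Integrable (fun ω => ‖∑ i ∈ Finset.range n, Z i ω‖ ^ 2) P ∧
    ∫ ω, ‖∑ i ∈ Finset.range n, Z i ω‖ ^ 2 ∂P ≤ a * (∫ z, ‖z‖ ^ 2 ∂μ) * n := by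
  set v := ∫ z, ‖z‖ ^ 2 ∂μ with hv
  have hv0 : 0 ≤ v := integral_nonneg fun z => by positivity
  have hZ2 : ∀ i, MemLp (Z i) 2 P := fun i => by
    have h1 : MemLp (fun z : B => z) 2 (P.map (Z i)) := by rwa [hlaw i]
    exact h1.comp_of_map (hZm i).aemeasurable
  have hS2 : MemLp (fun ω => ∑ i ∈ Finset.range n, Z i ω) 2 P :=
    memLp_finsetSum _ fun i _ => hZ2 i
  refine ⟨hS2.integrable_norm_pow (by norm_num), ?_⟩
  have hi2 : Integrable (fun z : B => ‖z‖ ^ 2) μ := hμ2.integrable_norm_pow (by norm_num)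
  rcases hv0.eq_or_lt with h0 | hpos
  · have hz : ∀ᵐ z ∂μ, z = 0 := by
      have h1 := (integral_eq_zero_iff_of_nonneg (fun z => by positivity) hi2).1 h0.symm
      filter_upwards [h1] with z hz
      simpa using hz
    have hZz : ∀ᵐ ω ∂P, ∀ i, Z i ω = 0 := by
      rw [ae_all_iff]
      intro i
      rw [← hlaw i] at hz
      exact ae_of_ae_map (hZm i).aemeasurable hz
    have h2 : ∫ ω, ‖∑ i ∈ Finset.range n, Z i ω‖ ^ 2 ∂P = 0 := by
      refine integral_eq_zero_of_ae ?_
      filter_upwards [hZz] with ω hω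
      simp [hω]
    rw [h2, ← h0]; simp
  · set r := (Real.sqrt v)⁻¹ with hr
    have hr0 : 0 < r := by positivity
    have hr2 : r ^ 2 * v = 1 := by
      rw [hr, inv_pow, Real.sq_sqrt hv0]; field_simp
    have hrm : Measurable fun z : B => r • z := measurable_const_smul r
    set μ' := μ.map fun z => r • z
    have hμ' : IsProbabilityMeasure μ' := Measure.isProbabilityMeasure_map hrm.aemeasurable
    have h1 : MemLp (fun z : B => z) 2 μ' := by
      rw [memLp_map_measure_iff (by fun_prop) hrm.aemeasurable]
      exact hμ2.const_smul r
    have h2 : ∫ z, z ∂μ' = 0 := by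
      rw [integral_map hrm.aemeasurable (by fun_prop), integral_smul, hμ0, smul_zero]
    have h3 : ∫ z, ‖z‖ ^ 2 ∂μ' = 1 := by
      rw [integral_map hrm.aemeasurable (by fun_prop)]
      simp_rw [norm_smul, mul_pow]
      rw [integral_const_mul, Real.norm_eq_abs, sq_abs, hr2]
    have h4 := ha.2 μ' hμ' h1 h2 h3 n
    have h5 : ∀ i : Fin n, ∫ z : Fin n → B, ‖z i‖ ^ 2 ∂(Measure.pi fun _ => μ') = 1 := fun i => by
      rw [← h3]
      exact integral_comp_eval (μ := fun _ : Fin n => μ') (f := fun z : B => ‖z‖ ^ 2)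
        (by fun_prop)
    have hpi : (Measure.pi fun _ : Fin n => μ') =
        P.map fun ω (i : Fin n) => r • Z i ω := by
      rw [← Measure.pi_map_pi (fun _ => hrm.aemeasurable), ← map_fin_eq_pi hZm hZ hlaw n,
        Measure.map_map (by fun_prop) (by fun_prop)]
      rfl
    rw [hpi, integral_map (by fun_prop) (by fun_prop), ← hpi] at h4
    simp_rw [h5, ← Finset.smul_sum, norm_smul, mul_pow] at h4
    rw [integral_const_mul, Real.norm_eq_abs, sq_abs] at h4
    simp only [Finset.sum_const, Finset.card_univ, Fintype.card_fin, nsmul_eq_mul, mul_one] at h4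
    simp_rw [Finset.sum_range]
    have h6 := mul_le_mul_of_nonneg_left h4 hv0
    calc _ = v * (r ^ 2 * ∫ ω, ‖∑ i : Fin n, Z i ω‖ ^ 2 ∂P) := by
          rw [← mul_assoc, mul_comm v, hr2, one_mul]
      _ ≤ v * (a * n) := h6
      _ = _ := by ring

/-- A centred walk is at time `n` in the ball of radius `√(a v n)`, where `a` is a type 2 constant
and `v` the variance of the steps, with a probability that does not decay exponentially. At this
critical radius Chebyshev's inequality gives nothing at time `n`. It does give a lower bound at the
earlier time `(1 - θ) n`, with a radius shrunk by a constant; the remaining `θ n` steps then stay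
bounded with probability `e^{-O(θ n)}`. -/
lemma eventually_exp_le_measure_norm_sum_le [FiniteDimensional ℝ B] [IsProbabilityMeasure P]
    {μ : Measure B} [IsProbabilityMeasure μ] (hμ2 : MemLp (fun z : B => z) 2 μ)
    (hμ0 : ∫ z, z ∂μ = 0) (h : ∀ f : B →L[ℝ] ℝ, f ≠ 0 → μ {z | 0 < f z} ≠ 0)
    {Z : ℕ → Ω → B} (hZm : ∀ i, Measurable (Z i)) (hZ : iIndepFun Z P)
    (hlaw : ∀ i, P.map (Z i) = μ) {a : ℝ} (ha : IsTypeTwoConst B a) {η : ℝ} (hη : 0 < η) :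
    ∀ᶠ n : ℕ in atTop, Real.exp (-(η * n)) ≤
      P.real {ω | ‖∑ i ∈ Finset.range n, Z i ω‖ ≤
        Real.sqrt (a * ∫ z, ‖z‖ ^ 2 ∂μ) * Real.sqrt n} := by
  set v := ∫ z, ‖z‖ ^ 2 ∂μ with hv
  have hv0 : 0 ≤ v := integral_nonneg fun z => by positivity
  set c := Real.sqrt (a * v) with hc
  have hc2 : c ^ 2 = a * v := Real.sq_sqrt (mul_nonneg ha.1.le hv0)
  have hSm : ∀ n, Measurable fun ω => ∑ i ∈ Finset.range n, Z i ω := fun n =>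
    Finset.measurable_sum _ fun i _ => hZm i
  have hmarkov : ∀ (n : ℕ) (r : ℝ), 0 < r →
      1 - c ^ 2 * n / r ^ 2 ≤ P.real {ω | ‖∑ i ∈ Finset.range n, Z i ω‖ ≤ r} := by
    intro n r hr
    obtain ⟨hi, hle⟩ := integral_norm_sum_sq_le hμ2 hμ0 hZm hZ hlaw ha n
    have h1 := mul_meas_ge_le_integral_of_nonneg (μ := P) (ae_of_all _ fun ω => by positivity) hi
      (r ^ 2)
    have hms : MeasurableSet {ω | ‖∑ i ∈ Finset.range n, Z i ω‖ ≤ r} :=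
      measurableSet_le (hSm n).norm measurable_const
    have h2 : P.real {ω | ‖∑ i ∈ Finset.range n, Z i ω‖ ≤ r}ᶜ ≤ c ^ 2 * n / r ^ 2 := by
      rw [le_div_iff₀ (by positivity), hc2, mul_comm]
      refine le_trans ?_ (h1.trans hle)
      gcongr
      · exact measure_ne_top _ _
      · intro ω hω
        have : r < ‖∑ i ∈ Finset.range n, Z i ω‖ := not_le.1 hω
        exact pow_le_pow_left₀ hr.le this.le 2
    rw [probReal_compl_eq_one_sub hms] at h2
    linarith
  rcases (Real.sqrt_nonneg (a * v)).eq_or_lt with h0 | hcpos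
  · refine Eventually.of_forall fun n => ?_
    have hc0 : c = 0 := h0.symm
    have h1 : ∀ᵐ ω ∂P, ‖∑ i ∈ Finset.range n, Z i ω‖ ^ 2 = 0 := by
      obtain ⟨hi, hle⟩ := integral_norm_sum_sq_le hμ2 hμ0 hZm hZ hlaw ha n
      rw [← hv, ← hc2, hc0] at hle
      exact (integral_eq_zero_iff_of_nonneg (fun ω => by positivity) hi).1
        (le_antisymm (by simpa using hle) (integral_nonneg fun ω => by positivity))
    have h2 : P.real {ω | ‖∑ i ∈ Finset.range n, Z i ω‖ ≤ c * Real.sqrt n} = 1 := by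
      have h3 : {ω | ‖∑ i ∈ Finset.range n, Z i ω‖ ≤ c * Real.sqrt n} =ᵐ[P] Set.univ := by
        rw [eventuallyEq_univ]
        filter_upwards [h1] with ω hω
        rw [hc0, zero_mul]
        exact (pow_eq_zero_iff two_ne_zero |>.1 hω).le
      rw [measureReal_congr h3, probReal_univ]
    rw [h2]
    exact Real.exp_le_one_iff.2 (by have : 0 ≤ η * n := by positivity
                                    linarith)
  obtain ⟨R, p, hR, hp, hp1, hstep⟩ := exists_ball_step h
  set L : B ≃L[ℝ] EuclideanSpace ℝ (Fin (Module.finrank ℝ B)) := toEuclidean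
  set D := ‖(L.symm : EuclideanSpace ℝ (Fin (Module.finrank ℝ B)) →L[ℝ] B)‖ * R with hD
  have hD0 : 0 ≤ D := by positivity
  have hDle : ∀ z : B, ‖L z‖ ≤ R → ‖z‖ ≤ D := fun z hz => by
    calc ‖z‖ = ‖(L.symm : EuclideanSpace ℝ (Fin (Module.finrank ℝ B)) →L[ℝ] B) (L z)‖ := by simp
      _ ≤ ‖(L.symm : EuclideanSpace ℝ (Fin (Module.finrank ℝ B)) →L[ℝ] B)‖ * ‖L z‖ :=
        ContinuousLinearMap.le_opNorm _ _
      _ ≤ D := by rw [hD]; gcongr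
  have hlp : Real.log p ≤ 0 := Real.log_nonpos hp.le hp1
  set θ := min 1 (η / (2 * (1 - Real.log p))) with hθ
  have hθ0 : 0 < θ := lt_min one_pos (div_pos hη (by linarith))
  have hθ1 : θ ≤ 1 := min_le_left _ _
  have hθη : -(η / 2) ≤ θ * Real.log p := by
    have h1 : θ ≤ η / (2 * (1 - Real.log p)) := min_le_right _ _
    rw [le_div_iff₀ (by linarith)] at h1
    nlinarith
  have hev1 : ∀ᶠ n : ℕ in atTop, Real.exp (-(η / 2 * n)) ≤ θ / 2 * p := by
    have h1 : Tendsto (fun n : ℕ => Real.exp (-(η / 2 * n))) atTop (𝓝 0) :=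
      Real.tendsto_exp_neg_atTop_nhds_zero.comp
        (tendsto_natCast_atTop_atTop.const_mul_atTop (by positivity))
    filter_upwards [h1.eventually (gt_mem_nhds (by positivity : 0 < θ / 2 * p))] with n hn
      using le_of_lt hn
  have hev2 : ∀ᶠ n : ℕ in atTop, (4 * D / (θ * c) + D / c + 1) ≤ Real.sqrt n :=
    (Real.tendsto_sqrt_atTop.comp tendsto_natCast_atTop_atTop).eventually_ge_atTop _
  filter_upwards [hev1, hev2, eventually_ge_atTop 1] with n hn1 hn2 hn
  set q := Real.sqrt n with hq
  have hqn : q ^ 2 = n := Real.sq_sqrt (Nat.cast_nonneg n)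
  have hDc : 0 ≤ D / c := by positivity
  have hDtc : 0 ≤ 4 * D / (θ * c) := by positivity
  have hq0 : 0 < q := by linarith
  have hr0 : 0 < c * q - D := by
    have h1 : D / c < q := by linarith
    rw [div_lt_iff₀ hcpos] at h1
    linarith
  have hqD : 4 * D ≤ θ * c * q := by
    have h1 : 4 * D / (θ * c) ≤ q := by linarith
    rw [div_le_iff₀ (by positivity)] at h1
    linarith
  set k := ⌈θ * n⌉₊ with hk
  have hkn : k ≤ n := Nat.ceil_le.2 (by nlinarith [(Nat.cast_nonneg n : (0 : ℝ) ≤ n)])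
  have hk1 : θ * n ≤ k := Nat.le_ceil _
  have hk2 : (k : ℝ) ≤ θ * n + 1 := (Nat.ceil_lt_add_one (by positivity)).le
  -- The first `n - k` steps.
  have hfirst : θ / 2 ≤ P.real {ω | ‖∑ i ∈ Finset.range (n - k), Z i ω‖ ≤ c * q - D} := by
    refine le_trans ?_ (hmarkov (n - k) _ hr0)
    rw [Nat.cast_sub hkn, le_sub_iff_add_le, ← le_sub_iff_add_le', div_le_iff₀ (by positivity),
      ← hqn]
    rw [← hqn] at hk1
    have h1 : c ^ 2 * (q ^ 2 - k) ≤ c ^ 2 * (q ^ 2 - θ * q ^ 2) := by gcongr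
    have h2 : 4 * D * (c * q) ≤ θ * c * q * (c * q) := by gcongr
    have h3 : 0 ≤ (1 - θ / 2) * D ^ 2 := by
      have : 0 ≤ 1 - θ / 2 := by linarith
      positivity
    have h4 : 0 ≤ θ * (D * (c * q)) := by positivity
    nlinarith
  have hsecond := pow_le_measure_sum_Ico hZm hZ hlaw hR hp.le hstep (n - k) k
  rw [Nat.sub_add_cancel hkn] at hsecond
  have hindep : IndepFun (fun ω => ∑ i ∈ Finset.range (n - k), Z i ω)
      (fun ω => ∑ i ∈ Finset.Ico (n - k) n, Z i ω) P := by
    have hdisj : Disjoint (Finset.range (n - k)) (Finset.Ico (n - k) n) := by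
      rw [Finset.disjoint_left]
      intro i hi hi'
      simp only [Finset.mem_range, Finset.mem_Ico] at hi hi'
      omega
    have h1 := (hZ.indepFun_finset _ _ hdisj hZm).comp
      (φ := fun y => ∑ i, y i) (ψ := fun y => ∑ i, y i) (by fun_prop) (by fun_prop)
    convert h1 using 1
    · funext ω; exact (Finset.sum_coe_sort _ fun i => Z i ω).symm
    · funext ω; exact (Finset.sum_coe_sort _ fun i => Z i ω).symm
  have hmul := hindep.measure_inter_preimage_eq_mul {z | ‖z‖ ≤ c * q - D} {z | ‖L z‖ ≤ R}
    (isClosed_le (by fun_prop) continuous_const).measurableSet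
    (isClosed_le (by fun_prop) continuous_const).measurableSet
  have hincl : (fun ω => ∑ i ∈ Finset.range (n - k), Z i ω) ⁻¹' {z | ‖z‖ ≤ c * q - D} ∩
      (fun ω => ∑ i ∈ Finset.Ico (n - k) n, Z i ω) ⁻¹' {z | ‖L z‖ ≤ R} ⊆
      {ω | ‖∑ i ∈ Finset.range n, Z i ω‖ ≤ c * q} := by
    rintro ω ⟨h1, h2⟩
    have h1' : ‖∑ i ∈ Finset.range (n - k), Z i ω‖ ≤ c * q - D := h1
    have h2' := hDle _ h2
    have h3 := Finset.sum_range_add_sum_Ico (fun i => Z i ω) (Nat.sub_le n k)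
    have h4 := norm_add_le (∑ i ∈ Finset.range (n - k), Z i ω) (∑ i ∈ Finset.Ico (n - k) n, Z i ω)
    rw [h3] at h4
    have : ‖∑ i ∈ Finset.range n, Z i ω‖ ≤ c * q := by linarith
    exact this
  have hprob : θ / 2 * p ^ k ≤ P.real {ω | ‖∑ i ∈ Finset.range n, Z i ω‖ ≤ c * q} := by
    refine le_trans ?_ (measureReal_mono hincl)
    rw [measureReal_def, hmul, ENNReal.toReal_mul]
    exact mul_le_mul hfirst hsecond (by positivity) ENNReal.toReal_nonneg
  refine le_trans ?_ hprob
  have hpk : p * Real.exp (-(η / 2 * n)) ≤ p ^ k := by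
    rw [← Real.rpow_natCast, Real.rpow_def_of_pos hp]
    nth_rw 1 [← Real.exp_log hp]
    rw [← Real.exp_add, Real.exp_le_exp]
    have h1 : Real.log p * (θ * n + 1) ≤ Real.log p * k := mul_le_mul_of_nonpos_left hk2 hlp
    have h2 : -(η / 2) * n ≤ θ * Real.log p * n := by gcongr
    linarith
  calc Real.exp (-(η * n)) = Real.exp (-(η / 2 * n)) * Real.exp (-(η / 2 * n)) := by
        rw [← Real.exp_add]; ring_nf
    _ ≤ θ / 2 * p * Real.exp (-(η / 2 * n)) := by gcongr
    _ = θ / 2 * (p * Real.exp (-(η / 2 * n))) := by ring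
    _ ≤ θ / 2 * p ^ k := by gcongr

end SmallBall

/-! ### Densities of product measures -/

lemma lintegral_pi_prod {E ι : Type*} [MeasurableSpace E] [Fintype ι] (μ : Measure E)
    [IsProbabilityMeasure μ] {f : ι → E → ℝ≥0∞} (hf : ∀ i, Measurable (f i)) :
    ∫⁻ x, ∏ i, f i (x i) ∂(Measure.pi fun _ : ι => μ) = ∏ i, ∫⁻ y, f i y ∂μ := by
  have hind : iIndepFun (fun (i : ι) (x : ι → E) => f i (x i)) (Measure.pi fun _ : ι => μ) :=
    iIndepFun_pi fun i => (hf i).aemeasurable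
  rw [lintegral_prod_eq_prod_lintegral_of_indepFun Finset.univ _ hind fun i => by fun_prop]
  exact Finset.prod_congr rfl fun i _ =>
    (measurePreserving_eval (fun _ : ι => μ) i).lintegral_comp (hf i)

lemma pi_withDensity {E ι : Type*} [MeasurableSpace E] [Fintype ι] (μ : Measure E)
    [IsProbabilityMeasure μ] {d : E → ℝ≥0∞} (hd : Measurable d)
    [IsProbabilityMeasure (μ.withDensity d)] :
    (Measure.pi fun _ : ι => μ.withDensity d) =
      (Measure.pi fun _ : ι => μ).withDensity fun x => ∏ i, d (x i) := by
  refine Measure.pi_eq fun s hs => ?_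
  rw [withDensity_apply _ (MeasurableSet.univ_pi hs),
    ← lintegral_indicator (MeasurableSet.univ_pi hs)]
  have h1 : ∀ x : ι → E, (Set.univ.pi s).indicator (fun x => ∏ i, d (x i)) x =
      ∏ i, (s i).indicator d (x i) := fun x => by
    by_cases hx : x ∈ Set.univ.pi s
    · rw [Set.indicator_of_mem hx]
      exact Finset.prod_congr rfl fun i _ =>
        (Set.indicator_of_mem (hx i (Set.mem_univ i)) _).symm
    · rw [Set.indicator_of_notMem hx]
      simp only [Set.mem_univ_pi, not_forall] at hx
      obtain ⟨i, hi⟩ := hx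
      exact (Finset.prod_eq_zero (Finset.mem_univ i) (Set.indicator_of_notMem hi _)).symm
  simp_rw [h1]
  rw [lintegral_pi_prod μ fun i => hd.indicator (hs i)]
  exact Finset.prod_congr rfl fun i _ => by
    rw [lintegral_indicator (hs i), withDensity_apply _ (hs i)]

section TiltedPowers

variable {E B : Type*} [NormedAddCommGroup B] [NormedSpace ℝ B]

/-- The configurations `x` of `n` points whose empirical measure satisfies the moment constraint
`K`. -/
def momentEvent (F : E → B) (K : Set B) (n : ℕ) : Set (Fin n → E) :=
  {x | (n : ℝ)⁻¹ • ∑ i, F (x i) ∈ K}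

lemma preimage_perm_momentEvent (F : E → B) (K : Set B) (n : ℕ) (σ : Equiv.Perm (Fin n)) :
    (fun x : Fin n → E => x ∘ σ) ⁻¹' momentEvent F K n = momentEvent F K n := by
  ext x
  have h1 : ∑ i, F ((x ∘ σ) i) = ∑ i, F (x i) := Equiv.sum_comp σ fun i => F (x i)
  simp only [momentEvent, Set.mem_preimage, Set.mem_ofPred_eq, h1]

variable [MeasurableSpace E]

lemma tilted_eq_withDensity_exp {α : Measure E} [NeZero α] {F : E → B} {l : B →L[ℝ] ℝ}
    (hli : Integrable (fun x => Real.exp (l (F x))) α) :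
    (α.tilted fun x => l (F x)) = α.withDensity fun x =>
      ENNReal.ofReal (Real.exp (l (F x) - Real.log (∫ y, Real.exp (l (F y)) ∂α))) := by
  simp_rw [Real.exp_sub, Real.exp_log (integral_exp_pos hli)]
  rfl

variable [MeasurableSpace B] [BorelSpace B]

lemma eq_withDensity_tilted {α : Measure E} [NeZero α] {F : E → B} (hF : Measurable F)
    {l : B →L[ℝ] ℝ} (hli : Integrable (fun x => Real.exp (l (F x))) α) :
    α = (α.tilted fun x => l (F x)).withDensity fun x =>
      ENNReal.ofReal (Real.exp (Real.log (∫ y, Real.exp (l (F y)) ∂α) - l (F x))) := by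
  ext s hs
  have hm : Measurable fun x => l (F x) := by fun_prop
  rw [tilted_eq_withDensity_exp hli, ← withDensity_mul _ (by fun_prop) (by fun_prop)]
  have h1 : ((fun x => ENNReal.ofReal
      (Real.exp (l (F x) - Real.log (∫ y, Real.exp (l (F y)) ∂α)))) *
      fun x => ENNReal.ofReal
      (Real.exp (Real.log (∫ y, Real.exp (l (F y)) ∂α) - l (F x)))) = fun _ => 1 := by
    funext x
    rw [Pi.mul_apply, ← ENNReal.ofReal_mul (Real.exp_pos _).le, ← Real.exp_add]
    simp
  rw [h1]; simp

/-- A uniform exponential moment under a power of `α` passes to the same power of a tilted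
measure: since the domain of `Λ_F` is open, the density is in `L^p` for some `p > 1`, and the
product with the density is split by convexity of `exp`. -/
lemma exists_lintegral_exp_pi_tilted_le {α : Measure E} [IsProbabilityMeasure α]
    {F : E → B} (hF : Measurable F) (hdom : IsOpen (domLogLaplace F α)) {l : B →L[ℝ] ℝ}
    (hl : l ∈ domLogLaplace F α) (ι : Type*) [Fintype ι] :
    ∃ s M : ℝ, 0 < s ∧ 0 ≤ M ∧ ∀ g : (ι → E) → ℝ, Measurable g →
      ∫⁻ x, ENNReal.ofReal (Real.exp (|g x| / 2)) ∂(Measure.pi fun _ : ι => α) ≤ 4 →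
      ∫⁻ x, ENNReal.ofReal (Real.exp (s * |g x|))
        ∂(Measure.pi fun _ : ι => α.tilted fun x => l (F x)) ≤ ENNReal.ofReal M := by
  have hli := (mem_domLogLaplace_iff hF).1 hl
  have hprob : IsProbabilityMeasure (α.tilted fun x => l (F x)) := isProbabilityMeasure_tilted hli
  obtain ⟨t, htdom, ht0⟩ := (((eventually_add_smul_mem_domLogLaplace hdom hl l).filter_mono
    nhdsWithin_le_nhds).and (self_mem_nhdsWithin (s := Set.Ioi (0 : ℝ)))).exists
  have ht : 0 < t := ht0
  have hti := (mem_domLogLaplace_iff hF).1 htdom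
  have hm : Measurable fun x => l (F x) := by fun_prop
  set Λ := Real.log (∫ y, Real.exp (l (F y)) ∂α)
  set J := ∫⁻ x, ENNReal.ofReal (Real.exp ((1 + t) * (l (F x) - Λ))) ∂α
  have hJ : J ≠ ∞ := by
    have h1 : Integrable (fun x => Real.exp ((1 + t) * (l (F x) - Λ))) α := by
      refine (hti.mul_const (Real.exp (-((1 + t) * Λ)))).congr (ae_of_all _ fun x => ?_)
      simp only [← Real.exp_add]
      congr 1
      simp; ring
    exact h1.lintegral_lt_top.ne
  have hJk : J ^ Fintype.card ι ≠ ∞ := ENNReal.pow_ne_top hJ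
  have htp : 0 < 1 + t := by linarith
  refine ⟨t / (2 * (1 + t)), 4 + (J ^ Fintype.card ι).toReal, by positivity, by positivity,
    fun g hg hg4 => ?_⟩
  have hwd := tilted_eq_withDensity_exp (F := F) hli
  have hwp : IsProbabilityMeasure (α.withDensity fun x =>
      ENNReal.ofReal (Real.exp (l (F x) - Λ))) := by rwa [← hwd]
  rw [hwd, pi_withDensity α (by fun_prop),
    lintegral_withDensity_eq_lintegral_mul _ (by fun_prop) (by fun_prop)]
  calc ∫⁻ x, ((fun x : ι → E => ∏ i, ENNReal.ofReal (Real.exp (l (F (x i)) - Λ))) *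
          fun x => ENNReal.ofReal (Real.exp (t / (2 * (1 + t)) * |g x|))) x
          ∂(Measure.pi fun _ : ι => α)
      ≤ ∫⁻ x, (ENNReal.ofReal (Real.exp (|g x| / 2)) +
          ∏ i, ENNReal.ofReal (Real.exp ((1 + t) * (l (F (x i)) - Λ))))
          ∂(Measure.pi fun _ : ι => α) := by
        refine lintegral_mono fun x => ?_
        rw [Pi.mul_apply, ← ENNReal.ofReal_prod_of_nonneg fun _ _ => (Real.exp_pos _).le,
          ← ENNReal.ofReal_prod_of_nonneg fun _ _ => (Real.exp_pos _).le,
          ← Real.exp_sum, ← Real.exp_sum, ← Finset.mul_sum,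
          ← ENNReal.ofReal_mul (Real.exp_pos _).le, ← Real.exp_add,
          ← ENNReal.ofReal_add (Real.exp_pos _).le (Real.exp_pos _).le]
        refine ENNReal.ofReal_le_ofReal ?_
        set T := ∑ i, (l (F (x i)) - Λ)
        -- The exponent is a convex combination of `|g x| / 2` and `(1 + t) * T`.
        have h1 : T + t / (2 * (1 + t)) * |g x| ≤ max (|g x| / 2) ((1 + t) * T) := by
          have h2 : T + t / (2 * (1 + t)) * |g x| =
              (t * (|g x| / 2) + 1 * ((1 + t) * T)) / (1 + t) := by field_simp; ring
          rw [h2, div_le_iff₀ htp]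
          have h3 := le_max_left (|g x| / 2) ((1 + t) * T)
          have h4 := le_max_right (|g x| / 2) ((1 + t) * T)
          nlinarith
        refine (Real.exp_le_exp.2 h1).trans ?_
        rcases max_choice (|g x| / 2) ((1 + t) * T) with h | h <;> rw [h]
        · linarith [Real.exp_pos ((1 + t) * T)]
        · linarith [Real.exp_pos (|g x| / 2)]
    _ = ∫⁻ x, ENNReal.ofReal (Real.exp (|g x| / 2)) ∂(Measure.pi fun _ : ι => α) +
          J ^ Fintype.card ι := by
        have h1 := lintegral_pi_prod (ι := ι) α
          (f := fun _ x => ENNReal.ofReal (Real.exp ((1 + t) * (l (F x) - Λ))))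
          fun _ => by fun_prop
        rw [lintegral_add_left (by fun_prop), h1]
        simp [J]
    _ ≤ 4 + J ^ Fintype.card ι := by gcongr
    _ = ENNReal.ofReal (4 + (J ^ Fintype.card ι).toReal) := by
        rw [ENNReal.ofReal_add (by norm_num) ENNReal.toReal_nonneg, ENNReal.ofReal_toReal hJk]
        norm_num

/-! ### Conditioning a power measure on the mean of `F` -/

lemma measurableSet_momentEvent [FiniteDimensional ℝ B] {F : E → B} (hF : Measurable F) {K : Set B}
    (hK : IsClosed K) (n : ℕ) : MeasurableSet (momentEvent F K n) := by
  have h1 : Measurable fun x : Fin n → E => (n : ℝ)⁻¹ • ∑ i, F (x i) := by fun_prop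
  exact h1 hK.measurableSet

lemma empiricalMeasure_mem_momentConstraint_iff [FiniteDimensional ℝ B] {Ω : Type*}
    {F : E → B} (hF : Measurable F) (K : Set B) (X : ℕ → Ω → E) {n : ℕ} (hn : 1 ≤ n) (ω : Ω) :
    empiricalMeasure X n ω ∈ momentConstraint F K ↔
      (fun i : Fin n => X i ω) ∈ momentEvent F K n := by
  have hn0 : (n : ℝ≥0∞) ≠ 0 := by exact_mod_cast (by omega : n ≠ 0)
  have hd : ∀ i ∈ Finset.range n, Integrable F (Measure.dirac (X i ω)) := fun i _ =>
    integrable_dirac' hF.stronglyMeasurable (by simp)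
  have hint : Integrable F (empiricalMeasure X n ω) := by
    refine Integrable.smul_measure ?_ (ENNReal.inv_ne_top.2 hn0)
    exact integrable_finsetSum_measure.2 hd
  have hprob : IsProbabilityMeasure (empiricalMeasure X n ω) := by
    constructor
    simp [empiricalMeasure, ENNReal.inv_mul_cancel hn0]
  have hval : ∫ x, F x ∂(empiricalMeasure X n ω) = (n : ℝ)⁻¹ • ∑ i : Fin n, F (X i ω) := by
    rw [empiricalMeasure, integral_smul_measure, integral_finsetSum_measure hd,
      Finset.sum_range fun i => ∫ x, F x ∂(Measure.dirac (X i ω))]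
    simp only [integral_dirac' F _ hF.stronglyMeasurable, ENNReal.toReal_inv,
      ENNReal.toReal_natCast]
  simp only [momentConstraint, momentEvent, Set.mem_ofPred_eq, hval]
  exact ⟨fun h => h.2.2, fun h => ⟨hprob, hint, h⟩⟩

lemma condLaw_eq_map_cond_pi [FiniteDimensional ℝ B] {Ω : Type*} [MeasurableSpace Ω]
    {P : Measure Ω} [IsProbabilityMeasure P] {α : Measure E} [IsProbabilityMeasure α]
    {X : ℕ → Ω → E} (hXm : ∀ i, Measurable (X i)) (hX : iIndepFun X P)
    (hlaw : ∀ i, P.map (X i) = α) {F : E → B} (hF : Measurable F) {K : Set B} (hK : IsClosed K)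
    {n k : ℕ} (hn : 1 ≤ n) (hk : k ≤ n) :
    P {ω | empiricalMeasure X n ω ∈ momentConstraint F K} =
      (Measure.pi fun _ : Fin n => α) (momentEvent F K n) ∧
    condLaw P X (momentConstraint F K) n k =
      (cond (Measure.pi fun _ : Fin n => α) (momentEvent F K n)).map
        fun x (i : Fin k) => x (Fin.castLE hk i) := by
  have hA := measurableSet_momentEvent hF hK n
  have hT : Measurable fun ω (i : Fin n) => X i ω := by fun_prop
  have hset : {ω | empiricalMeasure X n ω ∈ momentConstraint F K} =
      (fun ω (i : Fin n) => X i ω) ⁻¹' momentEvent F K n := by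
    ext ω; exact empiricalMeasure_mem_momentConstraint_iff hF K X hn ω
  have hmap := map_fin_eq_pi hXm hX hlaw n
  have hP : P {ω | empiricalMeasure X n ω ∈ momentConstraint F K} =
      (Measure.pi fun _ : Fin n => α) (momentEvent F K n) := by
    rw [hset, ← hmap, Measure.map_apply hT hA]
  refine ⟨hP, ?_⟩
  have hcond : (cond P {ω | empiricalMeasure X n ω ∈ momentConstraint F K}).map
      (fun ω (i : Fin n) => X i ω) =
      cond (Measure.pi fun _ : Fin n => α) (momentEvent F K n) := by
    rw [ProbabilityTheory.cond, ProbabilityTheory.cond, Measure.map_smul, hP, hset,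
      ← Measure.restrict_map hT hA, hmap]
  rw [condLaw, ← hcond, Measure.map_map (by fun_prop) hT]
  rfl

/-- Let `l` be minimized over `K` at the mean `m` of the tilted measure `β`. On the event that the
empirical mean of `F` is `ε`-close to `K`, the density `dα^n/dβ^n` is at most
`e^{n (Λ - ⟨l, m⟩ + ‖l‖ ε)}`; where that mean is `ε`-close to `m`, the density is at least
`e^{n (Λ - ⟨l, m⟩ - ‖l‖ ε)}`. Dividing, the conditioned law has a density with respect to `β^n`
which is subexponential as soon as the `β^n`-probability of the last event is. -/
lemma cond_pi_momentEvent_le [FiniteDimensional ℝ B] {α : Measure E} [IsProbabilityMeasure α]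
    {F : E → B} (hF : Measurable F) {K : Set B} (hK : IsClosed K) {l : B →L[ℝ] ℝ}
    (hl : l ∈ domLogLaplace F α) {m : B} (hmK : m ∈ K) (hmin : ∀ y ∈ K, l m ≤ l y)
    {n : ℕ} (hn : 1 ≤ n) {ε γ : ℝ} (hε : 0 ≤ ε)
    (hball : ENNReal.ofReal (Real.exp (-γ)) ≤
      (Measure.pi fun _ : Fin n => α.tilted fun x => l (F x)) {x | ‖∑ i, (F (x i) - m)‖ ≤ n * ε}) :
    0 < (Measure.pi fun _ : Fin n => α) (momentEvent F (Metric.cthickening ε K) n) ∧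
    cond (Measure.pi fun _ : Fin n => α) (momentEvent F (Metric.cthickening ε K) n) ≤
      ENNReal.ofReal (Real.exp (2 * n * ‖l‖ * ε + γ)) •
        Measure.pi fun _ : Fin n => α.tilted fun x => l (F x) := by
  have hli := (mem_domLogLaplace_iff hF).1 hl
  have hprob : IsProbabilityMeasure (α.tilted fun x => l (F x)) := isProbabilityMeasure_tilted hli
  set β := α.tilted fun x => l (F x)
  set Λ := Real.log (∫ y, Real.exp (l (F y)) ∂α)
  set A := momentEvent F (Metric.cthickening ε K) n
  have hA : MeasurableSet A := measurableSet_momentEvent hF Metric.isClosed_cthickening n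
  have hn0 : (0 : ℝ) < n := by exact_mod_cast hn
  have hm : Measurable fun x => l (F x) := by fun_prop
  have hdens : (Measure.pi fun _ : Fin n => α) = (Measure.pi fun _ : Fin n => β).withDensity
      fun x => ENNReal.ofReal (Real.exp (n * Λ - ∑ i, l (F (x i)))) := by
    have h1 := eq_withDensity_tilted hF hli
    have h2 : IsProbabilityMeasure (β.withDensity fun x =>
      ENNReal.ofReal (Real.exp (Λ - l (F x)))) := by rwa [← h1]
    conv_lhs => rw [h1]
    rw [pi_withDensity β (by fun_prop)]
    congr 1
    funext x
    rw [← ENNReal.ofReal_prod_of_nonneg fun _ _ => (Real.exp_pos _).le, ← Real.exp_sum]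
    simp [Λ]
  have hmean : ∀ x : Fin n → E, ∑ i, l (F (x i)) = n * l ((n : ℝ)⁻¹ • ∑ i, F (x i)) := fun x => by
    rw [map_smul, map_sum, smul_eq_mul]; field_simp
  have hAge : ∀ x ∈ A, n * (l m - ‖l‖ * ε) ≤ ∑ i, l (F (x i)) := fun x hx => by
    have hx' : (n : ℝ)⁻¹ • ∑ i, F (x i) ∈ Metric.cthickening ε K := hx
    rw [hK.cthickening_eq_biUnion_closedBall hε] at hx'
    obtain ⟨y, hy, hxy⟩ := Set.mem_iUnion₂.1 hx'
    rw [hmean]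
    refine mul_le_mul_of_nonneg_left ?_ hn0.le
    have h1 := l.le_opNorm (y - (n : ℝ)⁻¹ • ∑ i, F (x i))
    rw [← dist_eq_norm, dist_comm] at h1
    have h2 : ‖l‖ * dist ((n : ℝ)⁻¹ • ∑ i, F (x i)) y ≤ ‖l‖ * ε := by gcongr; exact hxy
    have h3 := (abs_le.1 ((Real.norm_eq_abs _).symm.trans_le (h1.trans h2))).2
    rw [map_sub] at h3
    linarith [hmin y hy]
  set D := {x : Fin n → E | ‖∑ i, (F (x i) - m)‖ ≤ n * ε}
  have hD : MeasurableSet D := by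
    have : Measurable fun x : Fin n → E => ∑ i, (F (x i) - m) := by fun_prop
    exact measurableSet_le this.norm measurable_const
  have hsub : ∀ x : Fin n → E, (n : ℝ)⁻¹ • ∑ i, F (x i) - m =
      (n : ℝ)⁻¹ • ∑ i, (F (x i) - m) := fun x => by
    rw [Finset.sum_sub_distrib, smul_sub]
    simp [← Nat.cast_smul_eq_nsmul ℝ, smul_smul, hn0.ne']
  have hDd : ∀ x ∈ D, ‖(n : ℝ)⁻¹ • ∑ i, F (x i) - m‖ ≤ ε := fun x hx => by
    have hx' : ‖∑ i, (F (x i) - m)‖ ≤ n * ε := hx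
    rw [hsub, norm_smul, norm_inv, Real.norm_natCast, inv_mul_le_iff₀ hn0]
    exact hx'
  have hDA : D ⊆ A := fun x hx =>
    Metric.mem_cthickening_of_dist_le _ m ε K hmK (by rw [dist_eq_norm]; exact hDd x hx)
  have hDle : ∀ x ∈ D, ∑ i, l (F (x i)) ≤ n * (l m + ‖l‖ * ε) := fun x hx => by
    rw [hmean]
    refine mul_le_mul_of_nonneg_left ?_ hn0.le
    have h1 := l.le_opNorm ((n : ℝ)⁻¹ • ∑ i, F (x i) - m)
    have h2 : ‖l‖ * ‖(n : ℝ)⁻¹ • ∑ i, F (x i) - m‖ ≤ ‖l‖ * ε := by gcongr; exact hDd x hx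
    have h3 := (abs_le.1 ((Real.norm_eq_abs _).symm.trans_le (h1.trans h2))).2
    rw [map_sub] at h3
    linarith
  have hlow : ENNReal.ofReal (Real.exp (n * (Λ - l m) - n * ‖l‖ * ε - γ)) ≤
      (Measure.pi fun _ : Fin n => α) A := by
    calc ENNReal.ofReal (Real.exp (n * (Λ - l m) - n * ‖l‖ * ε - γ))
        = ENNReal.ofReal (Real.exp (n * (Λ - l m) - n * ‖l‖ * ε)) *
            ENNReal.ofReal (Real.exp (-γ)) := by
          rw [← ENNReal.ofReal_mul (Real.exp_pos _).le, ← Real.exp_add]; rfl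
      _ ≤ ENNReal.ofReal (Real.exp (n * (Λ - l m) - n * ‖l‖ * ε)) *
            (Measure.pi fun _ : Fin n => β) D := by gcongr
      _ = ∫⁻ _ in D, ENNReal.ofReal (Real.exp (n * (Λ - l m) - n * ‖l‖ * ε))
            ∂(Measure.pi fun _ : Fin n => β) := by rw [setLIntegral_const]
      _ ≤ ∫⁻ x in D, ENNReal.ofReal (Real.exp (n * Λ - ∑ i, l (F (x i))))
            ∂(Measure.pi fun _ : Fin n => β) := by
          refine setLIntegral_mono' hD fun x hx => ?_
          have := hDle x hx
          refine ENNReal.ofReal_le_ofReal (Real.exp_le_exp.2 ?_)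
          linarith
      _ = (Measure.pi fun _ : Fin n => α) D := by rw [hdens, withDensity_apply _ hD]
      _ ≤ (Measure.pi fun _ : Fin n => α) A := measure_mono hDA
  have hpos : 0 < (Measure.pi fun _ : Fin n => α) A :=
    (ENNReal.ofReal_pos.2 (Real.exp_pos _)).trans_le hlow
  refine ⟨hpos, Measure.le_iff.2 fun s hs => ?_⟩
  have hup : (Measure.pi fun _ : Fin n => α) (A ∩ s) ≤
      ENNReal.ofReal (Real.exp (n * (Λ - l m) + n * ‖l‖ * ε)) *
        (Measure.pi fun _ : Fin n => β) s := by
    calc (Measure.pi fun _ : Fin n => α) (A ∩ s)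
        = ∫⁻ x in A ∩ s, ENNReal.ofReal (Real.exp (n * Λ - ∑ i, l (F (x i))))
            ∂(Measure.pi fun _ : Fin n => β) := by
          rw [hdens, withDensity_apply _ (hA.inter hs)]
      _ ≤ ∫⁻ _ in A ∩ s, ENNReal.ofReal (Real.exp (n * (Λ - l m) + n * ‖l‖ * ε))
            ∂(Measure.pi fun _ : Fin n => β) := by
          refine setLIntegral_mono' (hA.inter hs) fun x hx => ?_
          have := hAge x hx.1
          refine ENNReal.ofReal_le_ofReal (Real.exp_le_exp.2 ?_)
          linarith
      _ = ENNReal.ofReal (Real.exp (n * (Λ - l m) + n * ‖l‖ * ε)) *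
            (Measure.pi fun _ : Fin n => β) (A ∩ s) := by rw [setLIntegral_const]
      _ ≤ _ := by gcongr; exact Set.inter_subset_right
  rw [cond_apply hA, Measure.smul_apply, smul_eq_mul]
  calc ((Measure.pi fun _ : Fin n => α) A)⁻¹ * (Measure.pi fun _ : Fin n => α) (A ∩ s)
      ≤ (ENNReal.ofReal (Real.exp (n * (Λ - l m) - n * ‖l‖ * ε - γ)))⁻¹ *
          (ENNReal.ofReal (Real.exp (n * (Λ - l m) + n * ‖l‖ * ε)) *
            (Measure.pi fun _ : Fin n => β) s) := by gcongr
    _ = _ := by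
        rw [← ENNReal.ofReal_inv_of_pos (Real.exp_pos _), ← mul_assoc,
          ← ENNReal.ofReal_mul (by positivity), ← Real.exp_neg, ← Real.exp_add]
        ring_nf

/-- The small-ball estimate under powers of a tilted measure. -/
lemma eventually_exp_le_pi_tilted [FiniteDimensional ℝ B] {β : Measure E} [IsProbabilityMeasure β]
    {F : E → B} (hF : Measurable F) (hF2 : MemLp F 2 β)
    (h : ∀ f : B →L[ℝ] ℝ, f ≠ 0 → β {x | 0 < f (F x - ∫ y, F y ∂β)} ≠ 0)
    {a : ℝ} (ha : IsTypeTwoConst B a) {ε : ℕ → ℝ}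
    (hε : ∀ n : ℕ, 1 ≤ n → Real.sqrt (a * vecVariance F β) / Real.sqrt n < ε n)
    {η : ℝ} (hη : 0 < η) :
    ∀ᶠ n : ℕ in atTop, ENNReal.ofReal (Real.exp (-(η * n))) ≤
      (Measure.pi fun _ : Fin n => β) {x | ‖∑ i, (F (x i) - ∫ y, F y ∂β)‖ ≤ n * ε n} := by
  set m := ∫ y, F y ∂β with hm
  have hFm : Measurable fun x => F x - m := hF.sub_const m
  have hFi : Integrable F β := hF2.integrable one_le_two
  set μ := β.map fun x => F x - m
  have hμ : IsProbabilityMeasure μ := Measure.isProbabilityMeasure_map hFm.aemeasurable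
  set P := Measure.infinitePi fun _ : ℕ => β
  have hcoord : iIndepFun (fun (i : ℕ) (ω : ℕ → E) => ω i) P :=
    iIndepFun_infinitePi (X := fun _ x => x) fun _ => measurable_id
  have hcoordlaw : ∀ i : ℕ, P.map (fun ω : ℕ → E => ω i) = β := fun i =>
    Measure.infinitePi_map_eval (fun _ : ℕ => β) i
  have hZ : iIndepFun (fun (i : ℕ) (ω : ℕ → E) => F (ω i) - m) P :=
    iIndepFun_infinitePi (X := fun _ x => F x - m) fun _ => hFm
  have hlaw : ∀ i : ℕ, P.map (fun ω : ℕ → E => F (ω i) - m) = μ := fun i => by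
    have h1 : P.map ((fun x => F x - m) ∘ fun ω : ℕ → E => ω i) = μ := by
      rw [← Measure.map_map hFm (by fun_prop), hcoordlaw i]
    exact h1
  have hμ2 : MemLp (fun z : B => z) 2 μ := by
    rw [memLp_map_measure_iff (by fun_prop) hFm.aemeasurable]
    exact hF2.sub (memLp_const m)
  have hμ0 : ∫ z, z ∂μ = 0 := by
    rw [integral_map hFm.aemeasurable (by fun_prop), integral_sub hFi (integrable_const _)]
    simp [← hm]
  have hμnd : ∀ f : B →L[ℝ] ℝ, f ≠ 0 → μ {z | 0 < f z} ≠ 0 := fun f hf => by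
    rw [Measure.map_apply hFm (measurableSet_lt measurable_const f.continuous.measurable)]
    exact h f hf
  have hvar : ∫ z, ‖z‖ ^ 2 ∂μ = vecVariance F β := by
    rw [integral_map hFm.aemeasurable (by fun_prop), vecVariance]
  have hsb := eventually_exp_le_measure_norm_sum_le hμ2 hμ0 hμnd (fun i => by fun_prop) hZ hlaw
    ha hη
  filter_upwards [hsb, eventually_ge_atTop 1] with n hn hn1
  rw [hvar] at hn
  have hset : MeasurableSet {x : Fin n → E | ‖∑ i, (F (x i) - m)‖ ≤ n * ε n} := by
    have : Measurable fun x : Fin n → E => ∑ i, (F (x i) - m) := by fun_prop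
    exact measurableSet_le this.norm measurable_const
  rw [← map_fin_eq_pi (P := P) (fun i => measurable_pi_apply i) hcoord hcoordlaw n,
    Measure.map_apply (by fun_prop) hset]
  refine (ENNReal.ofReal_le_ofReal hn).trans ?_
  rw [ofReal_measureReal]
  refine measure_mono fun ω hω => ?_
  have hω' : ‖∑ i ∈ Finset.range n, (F (ω i) - m)‖ ≤
      Real.sqrt (a * vecVariance F β) * Real.sqrt n := hω
  have hs0 : 0 < Real.sqrt n := Real.sqrt_pos.2 (by exact_mod_cast hn1)
  have h1 := hε n hn1
  rw [div_lt_iff₀ hs0] at h1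
  have h2 : ‖∑ i : Fin n, (F (ω i) - m)‖ ≤ n * ε n := by
    rw [← Finset.sum_range fun i => F (ω i) - m]
    refine hω'.trans ?_
    calc Real.sqrt (a * vecVariance F β) * Real.sqrt n
        ≤ ε n * Real.sqrt n * Real.sqrt n := by gcongr
      _ = n * ε n := by rw [mul_assoc, Real.mul_self_sqrt (Nat.cast_nonneg n), mul_comm]
  exact h2

end TiltedPowers

/-! ### Convergence of the conditional laws -/

/-- Entropy bound for the law of `k` coordinates under a symmetric conditioning of a power measure
whose density with respect to `β^n` is at most `e^δ`. -/
lemma klDiv_map_cond_pi_le {E : Type*} [MeasurableSpace E] {α β : Measure E}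
    [IsProbabilityMeasure α] [IsProbabilityMeasure β] {n k : ℕ} (hk : 1 ≤ k) (hkn : k ≤ n)
    {A : Set (Fin n → E)} (hA : MeasurableSet A)
    (hsymm : ∀ σ : Equiv.Perm (Fin n), (fun x : Fin n → E => x ∘ σ) ⁻¹' A = A)
    (hpos : (Measure.pi fun _ : Fin n => α) A ≠ 0) {δ : ℝ}
    (hle : cond (Measure.pi fun _ : Fin n => α) A ≤
      ENNReal.ofReal (Real.exp δ) • Measure.pi fun _ : Fin n => β) :
    InformationTheory.klDiv ((cond (Measure.pi fun _ : Fin n => α) A).map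
      fun x (i : Fin k) => x (Fin.castLE hkn i)) (Measure.pi fun _ : Fin k => β) ≤
      ENNReal.ofReal (δ / (n / k : ℕ)) := by
  have hb : n / k * k ≤ n := Nat.div_mul_le_self n k
  have hbpos : 0 < n / k := Nat.div_pos hkn hk
  have : Nonempty (Fin (n / k)) := ⟨⟨0, hbpos⟩⟩
  have hprob := cond_isProbabilityMeasure hpos
  set e : Fin (n / k) × Fin k → Fin n := fun p => Fin.castLE hb (finProdFinEquiv p)
  have he : Function.Injective e :=
    (Fin.castLE_injective hb).comp finProdFinEquiv.injective
  have h1 := klDiv_block_le β (cond (Measure.pi fun _ : Fin n => α) A) hle he _ fun j =>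
    map_cond_pi_eq_of_symm α hA hsymm (e := fun i => e (j, i)) (e' := Fin.castLE hkn)
      (fun i i' hii => (Prod.mk.inj (he hii)).2) (Fin.castLE_injective hkn)
  simpa using h1

/-- If the law of the `n`-point configuration conditioned on a symmetric event has a density with
respect to `β^n` that is eventually at most `e^{ηn}`, for all `η > 0`, then the entropy of its
`k`-point marginals relative to `β^k` tends to zero. -/
lemma tendsto_klDiv_of_subexponential {E : Type*} [MeasurableSpace E] {α β : Measure E}
    [IsProbabilityMeasure α] [IsProbabilityMeasure β] {A : (n : ℕ) → Set (Fin n → E)}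
    (hA : ∀ n, MeasurableSet (A n))
    (hsymm : ∀ n, ∀ σ : Equiv.Perm (Fin n), (fun x : Fin n → E => x ∘ σ) ⁻¹' A n = A n)
    (hdens : ∀ η : ℝ, 0 < η → ∀ᶠ n : ℕ in atTop, 0 < (Measure.pi fun _ : Fin n => α) (A n) ∧
      cond (Measure.pi fun _ : Fin n => α) (A n) ≤
        ENNReal.ofReal (Real.exp (η * n)) • Measure.pi fun _ : Fin n => β)
    {k : ℕ} (hk : 1 ≤ k) {ν : ℕ → Measure (Fin k → E)}
    (hν : ∀ n (hkn : k ≤ n), ν n = (cond (Measure.pi fun _ : Fin n => α) (A n)).map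
      fun x (i : Fin k) => x (Fin.castLE hkn i)) :
    Tendsto (fun n => InformationTheory.klDiv (ν n) (Measure.pi fun _ : Fin k => β))
      atTop (𝓝 0) := by
  rw [ENNReal.tendsto_nhds_zero]
  intro ε hε
  wlog hεt : ε ≠ ∞ generalizing ε
  · simp only [ne_eq, not_not] at hεt
    simp [hεt]
  have he : 0 < ε.toReal := ENNReal.toReal_pos hε.ne' hεt
  have hk0 : (0 : ℝ) < k := by exact_mod_cast hk
  filter_upwards [hdens (ε.toReal / (2 * k)) (by positivity), eventually_ge_atTop k]
    with n ⟨hpos, hle⟩ hkn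
  rw [hν n hkn]
  refine (klDiv_map_cond_pi_le hk hkn (hA n) (hsymm n) hpos.ne' hle).trans ?_
  rw [← ENNReal.ofReal_toReal hεt]
  refine ENNReal.ofReal_le_ofReal ?_
  have hbpos : 0 < n / k := Nat.div_pos hkn hk
  have hb0 : (0 : ℝ) < (n / k : ℕ) := by exact_mod_cast hbpos
  rw [div_le_iff₀ hb0, ENNReal.toReal_ofReal he.le]
  -- There are at least `n / (2 k)` disjoint blocks of length `k`.
  have hn : (n : ℝ) ≤ 2 * k * (n / k : ℕ) := by
    have h1 := Nat.div_add_mod n k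
    have h2 := Nat.mod_lt n hk
    have h3 : k ≤ k * (n / k) := Nat.le_mul_of_pos_right k hbpos
    have h4 : n ≤ 2 * k * (n / k) := by nlinarith
    exact_mod_cast h4
  calc ε.toReal / (2 * k) * n ≤ ε.toReal / (2 * k) * (2 * k * (n / k : ℕ)) := by gcongr
    _ = ε.toReal * (n / k : ℕ) := by field_simp

end ThinSets

theorem theorem3p8 {E B Ω : Type*}
    [TopologicalSpace E] [PolishSpace E] [MeasurableSpace E] [BorelSpace E]
    [NormedAddCommGroup B] [NormedSpace ℝ B] [FiniteDimensional ℝ B]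
    [MeasurableSpace B] [BorelSpace B]
    [MeasurableSpace Ω] (P : Measure Ω) [IsProbabilityMeasure P]
    (α : Measure E) [IsProbabilityMeasure α]
    -- i.i.d. variables with common law `α`
    (X : ℕ → Ω → E) (hXm : ∀ i, Measurable (X i)) (hXindep : iIndepFun X P)
    (hXlaw : ∀ i, P.map (X i) = α)
    -- the map `F` and the constraint set `K`
    (F : E → B) (hF : Measurable F)
    (hFτ : ThinSets.MemOrlicz (fun x => ‖F x‖) α)
    (hdom : IsOpen (ThinSets.domLogLaplace F α))
    (K : Set B) (hKclosed : IsClosed K) (hKconv : Convex ℝ K)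
    (hK : (K ∩ interior (convexHull ℝ (α.map F).support)).Nonempty)
    (a : ℝ) (ha : ThinSets.IsTypeTwoConst B a) :
    ∃ αs : Measure E,
      ThinSets.IsIProjection α (ThinSets.momentConstraint F K) αs ∧
      (∀ β : Measure E, ThinSets.IsIProjection α (ThinSets.momentConstraint F K) β → β = αs) ∧
      MemLp F 2 αs ∧
      ∀ ε : ℕ → ℝ, Tendsto ε atTop (𝓝 0) →
        (∀ n : ℕ, 1 ≤ n → Real.sqrt (a * ThinSets.vecVariance F αs) / Real.sqrt n < ε n) →
        (∀ᶠ n in atTop, 0 < P {ω | ThinSets.empiricalMeasure X n ω ∈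
          ThinSets.momentConstraint F (Metric.cthickening (ε n) K)}) ∧
        ∀ k : ℕ, 1 ≤ k →
          Tendsto (fun n => ThinSets.orliczDualDist (Measure.pi fun _ : Fin k => α)
            (ThinSets.condLaw P X
              (ThinSets.momentConstraint F (Metric.cthickening (ε n) K)) n k)
            (Measure.pi fun _ : Fin k => αs)) atTop (𝓝 0) ∧
          Tendsto (fun n => InformationTheory.klDiv
            (ThinSets.condLaw P X
              (ThinSets.momentConstraint F (Metric.cthickening (ε n) K)) n k)
            (Measure.pi fun _ : Fin k => αs)) atTop (𝓝 0) := by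
  obtain ⟨x₀, hx₀K, hx₀⟩ := hK
  have hnd : ∀ f : B →L[ℝ] ℝ, f ≠ 0 → α {x | 0 < f (F x - x₀)} ≠ 0 := fun f hf =>
    ThinSets.measure_pos_of_mem_interior_convexHull_support hF hx₀ hf
  obtain ⟨l, hl, hmK, hmin⟩ := ThinSets.exists_tilt hF hdom hKclosed hKconv hx₀K hnd
  obtain ⟨hproj, huniq⟩ := ThinSets.isIProjection_tilted hF hdom hl hmK hmin
  have hF2 : MemLp F 2 (α.tilted fun x => l (F x)) := ThinSets.memLp_tilted hF hdom hl 2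
  have hprob : IsProbabilityMeasure (α.tilted fun x => l (F x)) := hproj.1.1
  refine ⟨α.tilted fun x => l (F x), hproj, huniq, hF2, fun ε hε0 hε => ?_⟩
  have hεnn : ∀ n : ℕ, 1 ≤ n → 0 ≤ ε n := fun n hn => le_trans (by positivity) (hε n hn).le
  set A : (n : ℕ) → Set (Fin n → E) :=
    fun n => ThinSets.momentEvent F (Metric.cthickening (ε n) K) n
  have hA : ∀ n, MeasurableSet (A n) := fun n =>
    ThinSets.measurableSet_momentEvent hF Metric.isClosed_cthickening n
  have hdens : ∀ η : ℝ, 0 < η → ∀ᶠ n : ℕ in atTop,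
      0 < (Measure.pi fun _ : Fin n => α) (A n) ∧
      cond (Measure.pi fun _ : Fin n => α) (A n) ≤ ENNReal.ofReal (Real.exp (η * n)) •
        Measure.pi fun _ : Fin n => α.tilted fun x => l (F x) := fun η hη => by
    have hball := ThinSets.eventually_exp_le_pi_tilted hF hF2
      (fun f hf => ThinSets.measure_pos_tilted hF hdom hl hnd hf) ha hε (half_pos hη)
    have hsmall : ∀ᶠ n in atTop, ε n < η / (4 * (‖l‖ + 1)) :=
      hε0.eventually (gt_mem_nhds (by positivity))
    filter_upwards [hball, hsmall, eventually_ge_atTop 1] with n hn hn2 hn1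
    obtain ⟨h1, h2⟩ := ThinSets.cond_pi_momentEvent_le hF hKclosed hl hmK hmin hn1
      (hεnn n hn1) hn
    refine ⟨h1, h2.trans ?_⟩
    have hle : 2 * n * ‖l‖ * ε n + η / 2 * n ≤ η * n := by
      rw [lt_div_iff₀ (by positivity)] at hn2
      have h3 : ‖l‖ * ε n ≤ η / 4 := by nlinarith [hεnn n hn1, norm_nonneg l]
      have h4 : (0 : ℝ) ≤ n := Nat.cast_nonneg n
      nlinarith
    refine Measure.le_iff.2 fun s _ => ?_
    simp only [Measure.smul_apply, smul_eq_mul]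
    gcongr
  have hcl : ∀ n, IsClosed (Metric.cthickening (ε n) K) := fun n => Metric.isClosed_cthickening
  refine ⟨?_, fun k hk => ?_⟩
  · filter_upwards [hdens 1 one_pos, eventually_ge_atTop 1] with n hn hn1
    rw [(ThinSets.condLaw_eq_map_cond_pi hXm hXindep hXlaw hF (hcl n) hn1 le_rfl).1]
    exact hn.1
  · have hcond : ∀ n (hkn : k ≤ n),
        ThinSets.condLaw P X (ThinSets.momentConstraint F (Metric.cthickening (ε n) K)) n k =
          (cond (Measure.pi fun _ : Fin n => α) (A n)).map
            fun x (i : Fin k) => x (Fin.castLE hkn i) := fun n hkn =>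
      (ThinSets.condLaw_eq_map_cond_pi hXm hXindep hXlaw hF (hcl n) (hk.trans hkn) hkn).2
    have hkl := ThinSets.tendsto_klDiv_of_subexponential hA
      (fun n σ => ThinSets.preimage_perm_momentEvent F _ n σ) hdens hk hcond
    refine ⟨?_, hkl⟩
    obtain ⟨s, M, hs, hM, hexp⟩ := ThinSets.exists_lintegral_exp_pi_tilted_le hF hdom hl (Fin k)
    refine ThinSets.tendsto_orliczDualDist_zero hs hM hexp ?_ hkl
    filter_upwards [hdens 1 one_pos, eventually_ge_atTop k] with n ⟨hpos, hle⟩ hkn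
    have hc := cond_isProbabilityMeasure hpos.ne'
    have hm : Measurable fun (x : Fin n → E) (i : Fin k) => x (Fin.castLE hkn i) := by fun_prop
    rw [hcond n hkn]
    refine ⟨Measure.isProbabilityMeasure_map hm.aemeasurable,
      ENNReal.ofReal (Real.exp (1 * n)), ENNReal.ofReal_ne_top,
      (Measure.map_mono hle hm).trans_eq ?_⟩
    rw [Measure.map_smul, ThinSets.map_pi_comp_injective _ (Fin.castLE_injective hkn)]
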